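/- **Setting.** Let $X$ be a finite non-empty dataset. A (binary) hierarchical clustering of $X$ is a family of non-empty subsets of $X$ that contains $X$ and all singletons, in which any two members are nested or disjoint, and in which every member $A$ with $|A|>1$ is the disjoint union of two other members. For a family $S$ of clusters let $\mathrm{lvs}(S)$ be the set of its minimal members (leaves) and $\mathrm{sibs}(S)$ the set of unordered pairs $\{L,R\}\subseteq S$ with $L\cap R=\emptyset$, $L\cup R\in S$. Let $\mathbb T\subseteq\mathcal P(X)$ be a trellis: $X\in\mathbb T$, the children pairs of $P\in\mathbb T$ are the two-partitions $\{L,R\}$ of $P$ into non-empty $L,R\in\mathbb T$, and every $P\in\mathbb T$ with $|P|>1$ has such a pair. Let $\psi\ge 0$ be a cost on unordered pairs of clusters and $\mathbb H\ge 0$ a function on clusters that vanishes on singletons; put $\phi(S)=\sum_{\{L,R\}\in\mathrm{sibs}(S)}\psi(L,R)$, $h(S)=\sum_{A\in\mathrm{lvs}(S)}\mathbb H(A)$ and $f=\phi+h$. **State space.** The states are the families $S\ni X$ contained in some hierarchical clustering $K\subseteq\mathbb T$ of $X$ that contain, with each non-leaf, a children pair of it. The start is $\{X\}$; the goals are the hierarchical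 clusterings $K\subseteq\mathbb T$ of $X$; there is an edge from $S$ to each $S'$ obtained by splitting one or more leaves of $S$ into children pairs, and its cost is the sum of $\psi$ over the new sibling pairs. Let $C^*$ be the least cost of a path from the start to a goal. Assume that $h$ is consistent (monotone): $h(S)\le \mathrm{cost}(S,S')+h(S')$ for all edges. **Algorithm 1 (A\* on the trellis).** At any time a set $E$ of clusters (initially empty) has been explored. The heap of $A\in E$ holds, for each children pair $(L,R)$ of $A$, the tuple $(f_{LR},g_{LR},h_{LR},L,R)$ with $f_{LR}=g_{LR}+h_{LR}$, $g_{LR}=\psi(L,R)+\phi(H_\Xi(L))+\phi(H_\Xi(R))$ and $h_{LR}=h(H_\Xi(L))+h(H_\Xi(R))$, where $\Xi(A)$ is the pair in a tuple with least $f_{LR}$ in the heap of $A$ ($\Xi(A)=\emptyset$ if the heap is empty; ties are broken arbitrarily) and $H_\Xi(A)=\{A\}\cup\bigcup_{B\in\Xi(A)}H_\Xi(B)$. Each pass reads off the state $S=H_\Xi(X)$. If $h(S)=0$ and $|\mathrm{lvs}(S)|=|X|$, it returns $f(S)$ and $S$; otherwise it explores all non-singleton leaves of $S$, i.e. adds them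 to $E$, and brings all heap values up to date. **Search algorithms.** A search algorithm on the set of all families of subsets of $X$ is a deterministic procedure that is given the start, the goals and the heuristic values of a search problem on this set (edge costs in $[0,\infty]$, with $\infty$ for a missing edge) and then repeatedly either expands a state, which reveals the costs of its outgoing edges, or stops and outputs a number and a goal. It is admissible if on every search problem on this set that has a path of finite cost to a goal and a consistent heuristic with values in $[0,\infty)$ which is $0$ at the goals, it stops with the optimal cost and a goal that is reached at that cost. **Theorem (Optimal Efficiency).** Under these assumptions, for every way of breaking ties: 1. Algorithm 1 never gets stuck, never explores the same state twice, and makes at most $|\mathbb T|$ exploring passes; what it returns is a hierarchical clustering $S\subseteq\mathbb T$ of least $\phi$ among those in $\mathbb T$, with the value $\phi(S)=C^*$. 2. It simulates best-first A\* search on the state space: whenever it is at a state $S$ with explored set $E$, having explored the states $S_1,\dots,S_k$ before, there is a run of A\* (with some tie-breaking) that has expanded $S_1,\dots,S_k$ in this order, possibly with further states in between, all expanded states having a leaf in $E$, and in which $S$ is an open state with least $g+h$, with $g(S)=\phi(S)$, so that A\* may select $S$ next. Algorithm 1 returns $S$ if and only if $S$ is a goal. 3. Every state $S$ that Algorithm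 1 explores has $f(S)\le C^*$; and if $f(S)<C^*$, then every admissible search algorithm, run on the state space, expands $S$. 4. For every admissible search algorithm there is a way of breaking ties in Algorithm 1 for which Algorithm 1 explores at most as many states as that algorithm expands on the state space. -/

import Mathlib

open scoped NNReal ENNReal

namespace HClust

noncomputable section

/-! ### Heuristic search on weighted graphs, and the search procedure A* -/

/-- A search problem on a set `V` of states: a start state, goal states, the cost of the edge
between two states (the value `⊤` means that there is no edge) and a heuristic. -/
structure SearchProblem (V : Type*) where
  start : V
  goal : Set V
  cost : V → V → ℝ≥0∞
  h : V → ℝ≥0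

namespace SearchProblem

variable {V : Type*}

/-- `P.PathCost u v a`: there is a path from `u` to `v` of total cost `a`. -/
inductive PathCost (P : SearchProblem V) (u : V) : V → ℝ≥0∞ → Prop
  | refl : PathCost P u u 0
  | step {v w : V} {a : ℝ≥0∞} : PathCost P u v a → PathCost P u w (a + P.cost v w)

/-- The cost of a cheapest path from the start to a goal (`⊤` if no goal can be reached). -/
def optCost (P : SearchProblem V) : ℝ≥0∞ :=
  sInf {a | ∃ t ∈ P.goal, P.PathCost P.start t a}

/-- Consistency (monotonicity) of the heuristic: the estimate at `v` is at most the cost of going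
from `v` to `w` plus the estimate at `w`. -/
def Consistent (P : SearchProblem V) : Prop :=
  ∀ v w, (P.h v : ℝ≥0∞) ≤ P.cost v w + P.h w

end SearchProblem

/-- The data of an A* search: the open states, and the cost of the cheapest path found so far to
each state (`⊤` for a state that has not been generated). -/
structure AStarConfig (V : Type*) where
  opened : Set V
  g : V → ℝ≥0∞

namespace AStarConfig

variable {V : Type*}

open Classical in
/-- At the beginning only the start state is open. -/
def initial (P : SearchProblem V) : AStarConfig V where
  opened := {P.start}
  g := fun v => if v = P.start then 0 else ⊤

/-- `v` is an open state with least `f = g + h`; ties may be broken in any way. -/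
def Selects (P : SearchProblem V) (c : AStarConfig V) (v : V) : Prop :=
  v ∈ c.opened ∧ ∀ w ∈ c.opened, c.g v + P.h v ≤ c.g w + P.h w

/-- Expansion of `v`: `v` is closed, and every state to which the path through `v` is cheaper than
all paths found before becomes (or stays) open with the improved `g`. -/
def expand (P : SearchProblem V) (c : AStarConfig V) (v : V) : AStarConfig V where
  opened := {w | (w ∈ c.opened ∧ w ≠ v) ∨ c.g v + P.cost v w < c.g w}
  g := fun w => min (c.g w) (c.g v + P.cost v w)

end AStarConfig

/-- `AStarRun P l c`: some run of A* on `P` (for some way of breaking ties) has expanded the states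
in `l`, in this order, and is now at `c`. A selected goal state is returned, never expanded. -/
inductive AStarRun {V : Type*} (P : SearchProblem V) : List V → AStarConfig V → Prop
  | initial : AStarRun P [] (AStarConfig.initial P)
  | expand {l : List V} {c : AStarConfig V} {v : V} :
      AStarRun P l c → c.Selects P v → v ∉ P.goal → AStarRun P (l ++ [v]) (c.expand P v)

/-! ### Arbitrary search algorithms with the same information -/

/-- What a search algorithm can do next: expand a state, or stop with the cost of a cheapest
solution and a goal state. -/
inductive SearchAction (V : Type*)
  | expand (v : V)
  | output (cost : ℝ≥0∞) (goal : V)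

/-- A deterministic search algorithm. It knows the start state, the goal states and the heuristic,
and chooses its next action by what it has learnt so far: the list of expanded states, each with
its outgoing edges and their costs. Edges are revealed by expansions only. -/
def SearchAlgorithm (V : Type*) : Type _ :=
  V → Set V → (V → ℝ≥0) → List (V × (V → ℝ≥0∞)) → SearchAction V

namespace SearchAlgorithm

variable {V : Type*}

/-- `B.History P l`: at some moment of its run on `P`, the algorithm has learnt exactly `l`. -/
inductive History (B : SearchAlgorithm V) (P : SearchProblem V) :
    List (V × (V → ℝ≥0∞)) → Prop
  | nil : History B P []
  | expand {l : List (V × (V → ℝ≥0∞))} {v : V} :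
      History B P l → B P.start P.goal P.h l = SearchAction.expand v →
        History B P (l ++ [(v, P.cost v)])

/-- On `P` the algorithm stops with history `l` and output `(r, t)`. -/
def Halts (B : SearchAlgorithm V) (P : SearchProblem V) (l : List (V × (V → ℝ≥0∞)))
    (r : ℝ≥0∞) (t : V) : Prop :=
  B.History P l ∧ B P.start P.goal P.h l = SearchAction.output r t

/-- The algorithm is admissible: on every solvable search problem whose heuristic is consistent and
vanishes at the goals, it stops with the optimal cost and a goal state that is reached at this
cost. -/
def Admissible (B : SearchAlgorithm V) : Prop :=
  ∀ P : SearchProblem V, P.Consistent → (∀ t ∈ P.goal, P.h t = 0) → P.optCost ≠ ⊤ →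
    ∃ l r t, B.Halts P l r t ∧ r = P.optCost ∧ t ∈ P.goal ∧ P.PathCost P.start t r

end SearchAlgorithm

/-! ### Hierarchical clusterings of the dataset `α`, and the cluster trellis -/

variable {α : Type*} [Fintype α] [DecidableEq α]

/-- A (binary) hierarchical clustering of the dataset `α`. -/
structure IsHierarchicalClustering (S : Finset (Finset α)) : Prop where
  univ_mem : Finset.univ ∈ S
  singleton_mem : ∀ x : α, {x} ∈ S
  empty_notMem : ∅ ∉ S
  nested : ∀ A ∈ S, ∀ B ∈ S, A ⊆ B ∨ B ⊆ A ∨ Disjoint A B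
  binary : ∀ A ∈ S, 1 < A.card → ∃ L ∈ S, ∃ R ∈ S, Disjoint L R ∧ L ∪ R = A ∧ L ≠ A ∧ R ≠ A

/-- The leaves of a family of clusters: its minimal members. -/
def lvs (S : Finset (Finset α)) : Finset (Finset α) :=
  S.filter fun A => ∀ B ∈ S, ¬ B ⊂ A

open Classical in
/-- The (unordered) pairs of sibling clusters. -/
def sibs (S : Finset (Finset α)) : Finset (Sym2 (Finset α)) :=
  S.sym2.filter fun p => ∃ L R, p = s(L, R) ∧ Disjoint L R ∧ L ∪ R ∈ S

/-- The cost of a (partial) hierarchical clustering: the sum of `ψ` over its sibling pairs. -/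
def treeCost (ψ : Sym2 (Finset α) → ℝ≥0) (S : Finset (Finset α)) : ℝ≥0 :=
  ∑ p ∈ sibs S, ψ p

/-- The heuristic value of a (partial) hierarchical clustering: the sum over its leaves. -/
def treeHeur (H : Finset α → ℝ≥0) (S : Finset (Finset α)) : ℝ≥0 :=
  ∑ A ∈ lvs S, H A

/-- A cluster trellis on the dataset `α`: clusters, among them the root `univ`, such that all
vertices without children are data points (or the irrelevant empty set). Its edges are determined
by its vertices. -/
structure Trellis (α : Type*) [Fintype α] [DecidableEq α] where
  clusters : Finset (Finset α)
  univ_mem : Finset.univ ∈ clusters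
  exists_child : ∀ P ∈ clusters, 1 < P.card →
    ∃ C ∈ clusters, C.Nonempty ∧ C ⊂ P ∧ P \ C ∈ clusters

namespace Trellis

/-- `L, R` is a pair of children of `P` in the trellis: a two-partition of `P`. -/
def IsSplit (T : Trellis α) (P L R : Finset α) : Prop :=
  P ∈ T.clusters ∧ L ∈ T.clusters ∧ R ∈ T.clusters ∧ L.Nonempty ∧ R.Nonempty ∧
    Disjoint L R ∧ L ∪ R = P

/-- The hierarchical clusterings represented by the trellis. -/
def trees (T : Trellis α) : Set (Finset (Finset α)) :=
  {S | IsHierarchicalClustering S ∧ S ⊆ T.clusters}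

/-- A search state: a subset of a hierarchical clustering represented by the trellis that contains
the root and, with each cluster that is not a leaf of it, a pair of children of this cluster. -/
def IsState (T : Trellis α) (S : Finset (Finset α)) : Prop :=
  (∃ K ∈ T.trees, S ⊆ K) ∧ Finset.univ ∈ S ∧
    ∀ A ∈ S, A ∉ lvs S → ∃ L ∈ S, ∃ R ∈ S, T.IsSplit A L R

/-- `S'` arises from the state `S` by splitting some (at least one) of the leaves of `S` into pairs
of children. -/
def IsNeighbor (T : Trellis α) (S S' : Finset (Finset α)) : Prop :=
  T.IsState S ∧ ∃ K ⊆ lvs S, K.Nonempty ∧ ∃ l r : Finset α → Finset α,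
    (∀ A ∈ K, T.IsSplit A (l A) (r A)) ∧ S' = S ∪ K.image l ∪ K.image r

open Classical in
/-- The space of partial tree structures as a search problem: one starts with the root alone, an
edge costs what its new sibling pairs cost, and the goals are the hierarchical clusterings
represented by the trellis. -/
def stateSpace (T : Trellis α) (ψ : Sym2 (Finset α) → ℝ≥0) (H : Finset α → ℝ≥0) :
    SearchProblem (Finset (Finset α)) where
  start := {Finset.univ}
  goal := T.trees
  cost := fun S S' =>
    if T.IsNeighbor S S' then ((∑ p ∈ sibs S' \ sibs S, ψ p : ℝ≥0) : ℝ≥0∞) else ⊤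
  h := treeHeur H

end Trellis

/-! ### A* on the cluster trellis

`Ξ A` is the set of the two children that the trellis node `A` points to, empty if `A` points to
nothing; `E` is the set of the explored nodes, those whose min-heap has been instantiated. -/

open Classical in
/-- The (partial) hierarchical clustering below `A` that is encoded by the pointers: all clusters
that one reaches from `A`; see `treeOf_eq` for the recursive form. -/
def treeOf (Ξ : Finset α → Finset (Finset α)) (A : Finset α) : Finset (Finset α) :=
  Finset.univ.filter fun B => Relation.ReflTransGen (fun C D => D ∈ Ξ C) A B

theorem treeOf_eq (Ξ : Finset α → Finset (Finset α)) (A : Finset α) :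
    treeOf Ξ A = {A} ∪ (Ξ A).biUnion (treeOf Ξ) := by
  ext B
  simp only [treeOf, Finset.mem_filter, Finset.mem_univ, true_and, Finset.mem_union,
    Finset.mem_singleton, Finset.mem_biUnion]
  rw [Relation.ReflTransGen.cases_head_iff, eq_comm]

/-- The `g` value of the split `L, R` of `L ∪ R`. -/
def gLR (ψ : Sym2 (Finset α) → ℝ≥0) (Ξ : Finset α → Finset (Finset α)) (L R : Finset α) : ℝ≥0 :=
  ψ s(L, R) + ∑ p ∈ sibs (treeOf Ξ L), ψ p + ∑ p ∈ sibs (treeOf Ξ R), ψ p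

/-- The `h` value of the split `L, R` of `L ∪ R`. -/
def hLR (H : Finset α → ℝ≥0) (Ξ : Finset α → Finset (Finset α)) (L R : Finset α) : ℝ≥0 :=
  ∑ A ∈ lvs (treeOf Ξ L), H A + ∑ A ∈ lvs (treeOf Ξ R), H A

/-- The heap of the node `A`: the tuples `(f, g, h, L, R)` with `f = g + h`, for all pairs of
children of `A` if `A` has been explored. -/
def heap (T : Trellis α) (ψ : Sym2 (Finset α) → ℝ≥0) (H : Finset α → ℝ≥0)
    (E : Finset (Finset α)) (Ξ : Finset α → Finset (Finset α)) (A : Finset α) :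
    Set (ℝ≥0 × ℝ≥0 × ℝ≥0 × Finset α × Finset α) :=
  {e | A ∈ E ∧ ∃ L R, T.IsSplit A L R ∧
    e = (gLR ψ Ξ L R + hLR H Ξ L R, gLR ψ Ξ L R, hLR H Ξ L R, L, R)}

/-- Every node points to the children in a tuple at the top of its heap (ties may be broken in any
way), and to nothing if its heap is empty. -/
def IsPointers (T : Trellis α) (ψ : Sym2 (Finset α) → ℝ≥0) (H : Finset α → ℝ≥0)
    (E : Finset (Finset α)) (Ξ : Finset α → Finset (Finset α)) : Prop :=
  ∀ A, (heap T ψ H E Ξ A = ∅ ∧ Ξ A = ∅) ∨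
    ∃ f g h L R, (f, g, h, L, R) ∈ heap T ψ H E Ξ A ∧
      (∀ e ∈ heap T ψ H E Ξ A, f ≤ e.1) ∧ Ξ A = {L, R}

/-- The test for a goal state: the `h` value at the root is `0`, and there are as many leaves as
data points. -/
def AtGoal (H : Finset α → ℝ≥0) (Ξ : Finset α → Finset (Finset α)) : Prop :=
  treeHeur H (treeOf Ξ Finset.univ) = 0 ∧ (lvs (treeOf Ξ Finset.univ)).card = Fintype.card α

/-- `TrellisRun T ψ H E tr`: some run of A* on the trellis (for some way of breaking ties) has gone
through the main loop with the states `tr`, in this order, and has explored the nodes in `E`. In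
each pass the state is read off the pointers; unless it is a goal, its leaves are explored
(nothing is to be done for a singleton), and all heap values and pointers are brought up to date. -/
inductive TrellisRun (T : Trellis α) (ψ : Sym2 (Finset α) → ℝ≥0) (H : Finset α → ℝ≥0) :
    Finset (Finset α) → List (Finset (Finset α)) → Prop
  | initial : TrellisRun T ψ H ∅ []
  | explore {E : Finset (Finset α)} {tr : List (Finset (Finset α))}
      {Ξ : Finset α → Finset (Finset α)} :
      TrellisRun T ψ H E tr → IsPointers T ψ H E Ξ → ¬ AtGoal H Ξ →
        TrellisRun T ψ H
          (E ∪ (lvs (treeOf Ξ Finset.univ)).filter fun A => 1 < A.card)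
          (tr ++ [treeOf Ξ Finset.univ])

/-- Some run of A* on the trellis explores the states in `tr` and then returns the value `r`
and the hierarchical clustering `S`. -/
def TrellisReturns (T : Trellis α) (ψ : Sym2 (Finset α) → ℝ≥0) (H : Finset α → ℝ≥0)
    (tr : List (Finset (Finset α))) (r : ℝ≥0) (S : Finset (Finset α)) : Prop :=
  ∃ E Ξ, TrellisRun T ψ H E tr ∧ IsPointers T ψ H E Ξ ∧ AtGoal H Ξ ∧
    S = treeOf Ξ Finset.univ ∧ r = treeCost ψ S + treeHeur H S

end

end HClust

open HClust

/-!
Search states are exactly the partial binary trees with root `univ` all of whose branchings are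
splits in the trellis (`isState_iff`); cost and heuristic are additive over the two branches of such
a tree, which permits induction on trees. The edge costs telescope (`treeCost_add_cost`), so all
paths to a state have the same cost, the cost of the state itself. Consistency means that
`f = cost + heuristic` does not decrease along edges, and for a single cluster that its heuristic
value is at most the `f` value of any tree below it (`heur_le_fval`).

Let `E` be the set of explored clusters. The pointers encode a state whose split clusters are those
in `E` and whose leaves are not in `E`, and by the Bellman inequality at the clusters in `E` it has
the least `f` among all states without a leaf in `E` (`fval_treeOf_le`). Hierarchical clusterings
are such states, which bounds `f` by the optimal cost and gives the correctness of the output. Every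
pass moves an unexplored leaf into `E`; hence termination, and no state is repeated.

For the simulation of A*: as all paths to a state cost the same, A* never reopens a state. While the
state `S` encoded by the pointers is not selected, some open state with least `f` has a leaf in `E`,
either because its `f` is below `f S` or because it is a proper substate of `S`; A* may expand it
(`exists_selects`).

The efficiency statements rest on two adversary arguments. If an admissible algorithm does not
expand a state with `f` below the optimal cost, then an edge from this state to a goal can be added
without its noticing (`SearchAlgorithm.Admissible.mem_expanded`). If it does not expand a whole
cheapest path to the goal `t` that it outputs, then all states that it does not expand can be made
more expensive to leave (`SearchAlgorithm.Admissible.exists_expanded_path`). Hence, as long as `f`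
is below the optimal cost, the algorithm on the trellis is at states that are expanded anyway; after
that ties are broken in favour of `t`, so that its states are the parts of `t` visible through `E`.
These grow at least as fast as the states on the path expanded by the other algorithm, because each
pass explores all leaves at once, and the states on the remaining part of that path have not been
counted before (`PathThrough.exists_fresh`, `PathThrough.exists_returns`).
-/


namespace HClust

noncomputable section

/-! ### Paths in search problems -/

namespace SearchProblem

theorem exists_pathCost {V : Type*} {P : SearchProblem V} {r : V → V → Prop}
    (h : ∀ v w, r v w → P.cost v w ≠ ⊤) {u v : V} (huv : Relation.ReflTransGen r u v) :
    ∃ a ≠ ⊤, P.PathCost u v a := by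
  induction huv with
  | refl => exact ⟨0, ENNReal.zero_ne_top, .refl⟩
  | tail _ hvw ih =>
    obtain ⟨a, ha, hp⟩ := ih
    exact ⟨_, ENNReal.add_ne_top.2 ⟨ha, h _ _ hvw⟩, hp.step⟩

theorem PathCost.mono {V : Type*} {P P' : SearchProblem V} (h : ∀ v w, P'.cost v w ≤ P.cost v w)
    {u v : V} {a : ℝ≥0∞} (hp : P.PathCost u v a) : ∃ a' ≤ a, P'.PathCost u v a' := by
  induction hp with
  | refl => exact ⟨0, le_rfl, .refl⟩
  | step _ ih =>
    obtain ⟨a', ha', hp⟩ := ih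
    exact ⟨_, add_le_add ha' (h _ _), hp.step⟩

theorem optCost_le {V : Type*} {P : SearchProblem V} {t : V} {a : ℝ≥0∞} (ht : t ∈ P.goal)
    (h : P.PathCost P.start t a) : P.optCost ≤ a :=
  sInf_le ⟨t, ht, h⟩

end SearchProblem

/-! ### Adversary arguments against search algorithms -/

namespace SearchAlgorithm

variable {V : Type*} {B : SearchAlgorithm V} {P P' : SearchProblem V}
  {l l' : List (V × (V → ℝ≥0∞))} {r r' : ℝ≥0∞} {t t' : V}

theorem History.action_of_prefix (h : B.History P l) {x : V × (V → ℝ≥0∞)}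
    (hx : l' ++ [x] <+: l) :
    B P.start P.goal P.h l' = SearchAction.expand x.1 ∧ x.2 = P.cost x.1 := by
  induction h with
  | nil => simp at hx
  | @expand l v hl hv ih =>
    rw [List.prefix_concat_iff] at hx
    rcases hx with hx | hx
    · obtain ⟨rfl, hx'⟩ := List.append_inj' hx rfl
      obtain rfl := List.singleton_inj.1 hx'
      exact ⟨hv, rfl⟩
    · exact ih hx

/-- Every history is an initial part of the final one. -/
theorem Halts.prefix (h : B.Halts P l r t) (h' : B.History P l') : l' <+: l := by
  induction h' with
  | nil => exact List.nil_prefix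
  | @expand l' v hl' hv ih =>
    obtain ⟨m, rfl⟩ := ih
    cases m with
    | nil =>
      rw [List.append_nil] at h
      have := h.2
      rw [hv] at this
      cases this
    | cons x m =>
      have hx : l' ++ [x] <+: l' ++ x :: m := ⟨m, by simp⟩
      obtain ⟨h1, h2⟩ := h.1.action_of_prefix hx
      rw [hv] at h1
      obtain rfl : v = x.1 := SearchAction.expand.inj h1
      rwa [← h2]

/-- A search algorithm is deterministic. -/
theorem Halts.unique (h : B.Halts P l r t) (h' : B.Halts P l' r' t') : r = r' ∧ t = t' := by
  obtain rfl : l = l' :=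
    (h'.prefix h.1).eq_of_length_le (h.prefix h'.1).length_le
  have := h.2.symm.trans h'.2
  exact SearchAction.output.inj this

/-- An algorithm cannot tell apart two problems that differ in the outgoing edges of states which
it does not expand. -/
theorem Halts.congr (h : B.Halts P l r t) (hs : P'.start = P.start) (hg : P'.goal = P.goal)
    (hh : P'.h = P.h) (hc : ∀ v ∈ l.map Prod.fst, P'.cost v = P.cost v) :
    B.Halts P' l r t := by
  obtain ⟨h, ho⟩ := h
  refine ⟨?_, by rwa [hs, hg, hh]⟩
  clear ho
  induction h with
  | nil => exact .nil
  | @expand l v hl hv ih =>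
    rw [← hc v (by simp)]
    refine .expand (ih fun u hu => hc u ?_) (by rwa [hs, hg, hh])
    rw [List.map_append]
    exact List.mem_append_left _ hu

theorem Admissible.output (hB : B.Admissible) (hcons : P.Consistent)
    (hgoal : ∀ t ∈ P.goal, P.h t = 0) (hne : P.optCost ≠ ⊤) (h : B.Halts P l r t) :
    r = P.optCost ∧ t ∈ P.goal ∧ P.PathCost P.start t r := by
  obtain ⟨l', r', t', h', h1, h2, h3⟩ := hB P hcons hgoal hne
  obtain ⟨rfl, rfl⟩ := h.unique h'
  exact ⟨h1, h2, h3⟩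

/-- A state that can be reached with `g + h` below the optimal cost has to be expanded: otherwise
the algorithm would overlook an edge of cost `h` from this state to a goal, which is compatible
with the consistency of the heuristic and makes a cheaper solution. -/
theorem Admissible.mem_expanded (hB : B.Admissible) (hcons : P.Consistent)
    (hgoal : ∀ t ∈ P.goal, P.h t = 0) (hne : P.optCost ≠ ⊤) (h : B.Halts P l r t) {v : V}
    {a : ℝ≥0∞} (hv : P.PathCost P.start v a) (hlt : a + P.h v < P.optCost) :
    v ∈ l.map Prod.fst := by
  classical
  by_contra hvl
  obtain ⟨hr, ht, -⟩ := hB.output hcons hgoal hne h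
  let P' : SearchProblem V :=
    { P with cost := fun x y => if x = v ∧ y = t then (P.h v : ℝ≥0∞) else P.cost x y }
  have hle : ∀ x y, P'.cost x y ≤ P.cost x y := by
    intro x y
    by_cases hxy : x = v ∧ y = t
    · obtain ⟨rfl, rfl⟩ := hxy
      simpa [P', hgoal y ht] using hcons x y
    · simp [P', hxy]
  have hcons' : P'.Consistent := by
    intro x y
    by_cases hxy : x = v ∧ y = t
    · obtain ⟨rfl, rfl⟩ := hxy
      simp [P']
    · simpa [P', hxy] using hcons x y
  obtain ⟨a', ha', hp⟩ := hv.mono hle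
  have hopt : P'.optCost ≤ a + P.h v := by
    refine (SearchProblem.optCost_le (P := P') ht hp.step).trans ?_
    simp only [P', and_self, if_true]
    gcongr
  have h' : B.Halts P' l r t := h.congr rfl rfl rfl fun x hx => by
    have : x ≠ v := by rintro rfl; exact hvl hx
    simp [P', this]
  obtain ⟨hr', -, -⟩ := hB.output (P := P') hcons' hgoal (hopt.trans_lt hlt).ne_top h'
  exact ((hr'.symm.trans hr).symm.trans_le hopt).not_gt hlt

/-- An admissible algorithm expands all states but the last on some cheapest path to the goal that
it outputs: otherwise it could not exclude that the states which it has not expanded are left at a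
higher cost. -/
theorem Admissible.exists_expanded_path (hB : B.Admissible) (hcons : P.Consistent)
    (hgoal : ∀ t ∈ P.goal, P.h t = 0) (hne : P.optCost ≠ ⊤) (h : B.Halts P l r t) :
    t ∈ P.goal ∧ P.PathCost P.start t P.optCost ∧
      Relation.ReflTransGen (fun v w => P.cost v w ≠ ⊤ ∧ v ∈ l.map Prod.fst) P.start t := by
  classical
  obtain ⟨hr, ht, hpath⟩ := hB.output hcons hgoal hne h
  let P' : SearchProblem V :=
    { P with cost := fun x y => P.cost x y + if x ∈ l.map Prod.fst then 0 else 1 }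
  have hcons' : P'.Consistent := fun x y =>
    (hcons x y).trans (add_le_add_left (self_le_add_right _ _) _)
  have h' : B.Halts P' l r t := h.congr rfl rfl rfl fun x hx => by
    simp only [P', if_pos hx, add_zero]
  have hne' : P'.optCost ≠ ⊤ := by
    have key : ∀ v a, P.PathCost P.start v a → a ≠ ⊤ →
        ∃ b ≠ ⊤, P'.PathCost P'.start v b := by
      intro v a hp
      induction hp with
      | refl => exact fun _ => ⟨0, ENNReal.zero_ne_top, .refl⟩
      | @step v w a _ ih =>
        intro hfin
        rw [ENNReal.add_ne_top] at hfin
        obtain ⟨b, hb, hp⟩ := ih hfin.1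
        refine ⟨_, ENNReal.add_ne_top.2 ⟨hb, ENNReal.add_ne_top.2 ⟨hfin.2, ?_⟩⟩, hp.step⟩
        split_ifs <;> simp
    obtain ⟨b, hb, hp⟩ := key t r hpath (hr ▸ hne)
    exact ne_top_of_le_ne_top hb (SearchProblem.optCost_le ht hp)
  obtain ⟨-, -, hpath'⟩ := hB.output (P := P') hcons' hgoal hne' h'
  -- A path of `P'` leaves an unexpanded state, and then has a surcharge, or it does not.
  have key : ∀ v a, P'.PathCost P'.start v a → a ≠ ⊤ →
      (∃ b, P.PathCost P.start v b ∧ b + 1 ≤ a) ∨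
      Relation.ReflTransGen (fun v w => P.cost v w ≠ ⊤ ∧ v ∈ l.map Prod.fst) P.start v := by
    intro v a hp
    induction hp with
    | refl => exact fun _ => Or.inr .refl
    | @step v w a hp ih =>
      intro hfin
      obtain ⟨ha, hcost⟩ := ENNReal.add_ne_top.1 hfin
      have hcost' : P.cost v w ≠ ⊤ := (ENNReal.add_ne_top.1 hcost).1
      rcases ih ha with ⟨b, hb, hba⟩ | hR
      · refine Or.inl ⟨_, hb.step, ?_⟩
        rw [add_right_comm]
        exact add_le_add hba (self_le_add_right _ _)
      · by_cases hv : v ∈ l.map Prod.fst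
        · exact Or.inr (hR.tail ⟨hcost', hv⟩)
        · obtain ⟨b, hb, hpb⟩ := hp.mono (P' := P) fun x y => self_le_add_right _ _
          refine Or.inl ⟨_, hpb.step, ?_⟩
          simp only [P', if_neg hv]
          rw [add_assoc]
          gcongr
  refine ⟨ht, hr ▸ hpath, (key t r hpath' (hr ▸ hne)).resolve_left ?_⟩
  rintro ⟨b, hb, hbr⟩
  have h1 : P.optCost + 1 ≤ P.optCost := by
    refine le_trans ?_ (hr ▸ hbr)
    gcongr
    exact SearchProblem.optCost_le ht hb
  exact h1.not_gt (ENNReal.lt_add_right hne one_ne_zero)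

end SearchAlgorithm

variable {α : Type*} [Fintype α] [DecidableEq α]

variable {T : Trellis α} {ψ : Sym2 (Finset α) → ℝ≥0} {H : Finset α → ℝ≥0}
  {A B C L R : Finset α} {S S' SL SR K E E' w t p p' : Finset (Finset α)}
  {Ξ : Finset α → Finset (Finset α)} {tr : List (Finset (Finset α))}

/-! ### Partial trees -/

/-- `PartialTree T A S`: the family `S` is the set of nodes of a binary tree with root `A` each of
whose branchings is a split in the trellis. The leaves may be clusters of any size. -/
inductive PartialTree (T : Trellis α) : Finset α → Finset (Finset α) → Prop
  | leaf {A : Finset α} : A ∈ T.clusters → A.Nonempty → PartialTree T A {A}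
  | node {A L R : Finset α} {SL SR : Finset (Finset α)} : T.IsSplit A L R →
      PartialTree T L SL → PartialTree T R SR → PartialTree T A (insert A (SL ∪ SR))

/-- The `f` value of a partial clustering: its cost plus its heuristic value. -/
def fval (ψ : Sym2 (Finset α) → ℝ≥0) (H : Finset α → ℝ≥0) (S : Finset (Finset α)) : ℝ≥0 :=
  treeCost ψ S + treeHeur H S

theorem mem_lvs : A ∈ lvs S ↔ A ∈ S ∧ ∀ B ∈ S, ¬ B ⊂ A := by
  simp [lvs]

theorem mem_sibs : s(L, R) ∈ sibs S ↔ (L ∈ S ∧ R ∈ S) ∧ Disjoint L R ∧ L ∪ R ∈ S := by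
  simp only [sibs, Finset.mem_filter, Finset.mk_mem_sym2_iff, and_congr_right_iff]
  rintro -
  constructor
  · rintro ⟨L', R', h, hd, hu⟩
    rcases Sym2.eq_iff.1 h with ⟨rfl, rfl⟩ | ⟨rfl, rfl⟩
    · exact ⟨hd, hu⟩
    · exact ⟨hd.symm, by rwa [Finset.union_comm]⟩
  · exact fun h => ⟨L, R, rfl, h⟩

theorem sibs_mono (h : S ⊆ S') : sibs S ⊆ sibs S' := by
  intro p
  induction p with
  | _ L R =>
    rw [mem_sibs, mem_sibs]
    exact fun ⟨⟨h1, h2⟩, h3, h4⟩ => ⟨⟨h h1, h h2⟩, h3, h h4⟩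

namespace Trellis.IsSplit

theorem symm (h : T.IsSplit A L R) : T.IsSplit A R L :=
  ⟨h.1, h.2.2.1, h.2.1, h.2.2.2.2.1, h.2.2.2.1, h.2.2.2.2.2.1.symm,
    by rw [Finset.union_comm]; exact h.2.2.2.2.2.2⟩

theorem disjoint (h : T.IsSplit A L R) : Disjoint L R := h.2.2.2.2.2.1
theorem union_eq (h : T.IsSplit A L R) : L ∪ R = A := h.2.2.2.2.2.2
theorem left_nonempty (h : T.IsSplit A L R) : L.Nonempty := h.2.2.2.1
theorem right_nonempty (h : T.IsSplit A L R) : R.Nonempty := h.2.2.2.2.1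
theorem left_mem (h : T.IsSplit A L R) : L ∈ T.clusters := h.2.1
theorem right_mem (h : T.IsSplit A L R) : R ∈ T.clusters := h.2.2.1

theorem left_subset (h : T.IsSplit A L R) : L ⊆ A := h.union_eq ▸ Finset.subset_union_left
theorem right_subset (h : T.IsSplit A L R) : R ⊆ A := h.symm.left_subset

theorem left_ssubset (h : T.IsSplit A L R) : L ⊂ A := by
  refine h.left_subset.ssubset_of_ne ?_
  rintro rfl
  exact h.right_nonempty.ne_empty (h.disjoint.symm.eq_bot_of_le h.right_subset)

theorem right_ssubset (h : T.IsSplit A L R) : R ⊂ A := h.symm.left_ssubset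

theorem one_lt_card (h : T.IsSplit A L R) : 1 < A.card :=
  (Nat.succ_le_of_lt (Finset.card_pos.2 h.left_nonempty)).trans_lt
    (Finset.card_lt_card h.left_ssubset)

end Trellis.IsSplit

theorem Trellis.exists_isSplit (T : Trellis α) (hA : A ∈ T.clusters) (h : 1 < A.card) :
    ∃ L R, T.IsSplit A L R := by
  obtain ⟨C, hC, hne, hlt, hd⟩ := T.exists_child A hA h
  exact ⟨C, A \ C, hA, hC, hd, hne, Finset.sdiff_nonempty.2 hlt.2, Finset.disjoint_sdiff,
    Finset.union_sdiff_of_subset hlt.1⟩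

namespace PartialTree

theorem root_mem (h : PartialTree T A S) : A ∈ S := by
  cases h <;> simp

theorem subset_root (h : PartialTree T A S) : ∀ B ∈ S, B ⊆ A := by
  induction h with
  | leaf => simp
  | node hs _ _ ihL ihR =>
    intro B hB
    rw [Finset.mem_insert, Finset.mem_union] at hB
    rcases hB with rfl | hB | hB
    · exact subset_rfl
    · exact (ihL B hB).trans hs.left_subset
    · exact (ihR B hB).trans hs.right_subset

theorem nonempty (h : PartialTree T A S) : ∀ B ∈ S, B.Nonempty := by
  induction h with
  | leaf _ h => simpa
  | node hs _ _ ihL ihR =>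
    intro B hB
    rw [Finset.mem_insert, Finset.mem_union] at hB
    rcases hB with rfl | hB | hB
    · exact hs.left_nonempty.mono hs.left_subset
    · exact ihL B hB
    · exact ihR B hB

theorem mem_clusters (h : PartialTree T A S) : ∀ B ∈ S, B ∈ T.clusters := by
  induction h with
  | leaf h => simpa
  | node hs _ _ ihL ihR =>
    intro B hB
    rw [Finset.mem_insert, Finset.mem_union] at hB
    rcases hB with rfl | hB | hB
    · exact hs.1
    · exact ihL B hB
    · exact ihR B hB

/-- Clusters of the two branches of a partial tree are disjoint. -/
theorem disjoint_of_mem (hs : T.IsSplit A L R) (hL : PartialTree T L SL) (hR : PartialTree T R SR)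
    (hB : B ∈ SL) (hC : C ∈ SR) : Disjoint B C :=
  hs.disjoint.mono (hL.subset_root B hB) (hR.subset_root C hC)

theorem disjoint_branches (hs : T.IsSplit A L R) (hL : PartialTree T L SL)
    (hR : PartialTree T R SR) : Disjoint SL SR := by
  rw [Finset.disjoint_left]
  intro B hB hC
  exact (hL.nonempty B hB).ne_empty (disjoint_self.1 (disjoint_of_mem hs hL hR hB hC))

theorem disjoint_lvs (hs : T.IsSplit A L R) (hL : PartialTree T L SL)
    (hR : PartialTree T R SR) : Disjoint (lvs SL) (lvs SR) :=
  (disjoint_branches hs hL hR).mono (Finset.filter_subset _ _) (Finset.filter_subset _ _)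

theorem nested (h : PartialTree T A S) :
    ∀ B ∈ S, ∀ C ∈ S, B ⊆ C ∨ C ⊆ B ∨ Disjoint B C := by
  induction h with
  | leaf => simp
  | node hs hL hR ihL ihR =>
    have hsub := (node hs hL hR).subset_root
    intro B hB C hC
    have hB' := hsub B hB
    have hC' := hsub C hC
    rw [Finset.mem_insert, Finset.mem_union] at hB hC
    rcases hB with rfl | hB | hB
    · exact Or.inr (Or.inl hC')
    · rcases hC with rfl | hC | hC
      · exact Or.inl hB'
      · exact ihL B hB C hC
      · exact Or.inr (Or.inr (disjoint_of_mem hs hL hR hB hC))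
    · rcases hC with rfl | hC | hC
      · exact Or.inl hB'
      · exact Or.inr (Or.inr (disjoint_of_mem hs hL hR hC hB).symm)
      · exact ihR B hB C hC

theorem lvs_node (hs : T.IsSplit A L R) (hL : PartialTree T L SL) (hR : PartialTree T R SR) :
    lvs (insert A (SL ∪ SR)) = lvs SL ∪ lvs SR := by
  ext B
  simp only [mem_lvs, Finset.mem_union, Finset.mem_insert]
  constructor
  · rintro ⟨rfl | hB | hB, h⟩
    · exact absurd hs.left_ssubset (h L (Or.inr (Or.inl hL.root_mem)))
    · exact Or.inl ⟨hB, fun C hC => h C (Or.inr (Or.inl hC))⟩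
    · exact Or.inr ⟨hB, fun C hC => h C (Or.inr (Or.inr hC))⟩
  · rintro (⟨hB, h⟩ | ⟨hB, h⟩)
    · refine ⟨Or.inr (Or.inl hB), ?_⟩
      rintro C (rfl | hC | hC) hlt
      · exact hlt.2 ((hL.subset_root B hB).trans hs.left_subset)
      · exact h C hC hlt
      · exact (hR.nonempty C hC).ne_empty
          ((disjoint_of_mem hs hL hR hB hC).symm.eq_bot_of_le hlt.1)
    · refine ⟨Or.inr (Or.inr hB), ?_⟩
      rintro C (rfl | hC | hC) hlt
      · exact hlt.2 ((hR.subset_root B hB).trans hs.right_subset)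
      · exact (hL.nonempty C hC).ne_empty
          ((disjoint_of_mem hs hL hR hC hB).eq_bot_of_le hlt.1)
      · exact h C hC hlt

theorem lvs_leaf : lvs ({A} : Finset (Finset α)) = {A} := by
  ext B
  simp only [mem_lvs, Finset.mem_singleton, forall_eq]
  exact ⟨fun h => h.1, fun h => ⟨h, h ▸ (ssubset_irrefl _)⟩⟩

theorem sibs_leaf (hA : A.Nonempty) : sibs ({A} : Finset (Finset α)) = ∅ := by
  refine Finset.eq_empty_of_forall_notMem fun p => ?_
  induction p with
  | _ L R =>
    rw [mem_sibs]
    simp only [Finset.mem_singleton]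
    rintro ⟨⟨rfl, rfl⟩, hd, -⟩
    exact hA.ne_empty (disjoint_self.1 hd)

theorem sibs_node (hs : T.IsSplit A L R) (hL : PartialTree T L SL) (hR : PartialTree T R SR) :
    sibs (insert A (SL ∪ SR)) = insert s(L, R) (sibs SL ∪ sibs SR) := by
  -- Two disjoint members below `L`, with union in the tree, have their union in the left branch
  -- or equal to `A`; the latter is impossible.
  have key : ∀ P ∈ SL, ∀ Q ∈ SL, P ∪ Q ∈ insert A (SL ∪ SR) → P ∪ Q ∈ SL := by
    intro P hP Q hQ h
    have hsub : P ∪ Q ⊆ L := Finset.union_subset (hL.subset_root P hP) (hL.subset_root Q hQ)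
    rw [Finset.mem_insert, Finset.mem_union] at h
    rcases h with h | h | h
    · exact absurd (h ▸ hsub) hs.left_ssubset.2
    · exact h
    · exact absurd ((hs.disjoint.mono hsub (hR.subset_root _ h)).eq_bot_of_self)
        (hR.nonempty _ h).ne_empty
  have key' : ∀ P ∈ SR, ∀ Q ∈ SR, P ∪ Q ∈ insert A (SL ∪ SR) → P ∪ Q ∈ SR := by
    intro P hP Q hQ h
    have hsub : P ∪ Q ⊆ R := Finset.union_subset (hR.subset_root P hP) (hR.subset_root Q hQ)
    rw [Finset.mem_insert, Finset.mem_union] at h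
    rcases h with h | h | h
    · exact absurd (h ▸ hsub) hs.right_ssubset.2
    · exact absurd ((hs.disjoint.symm.mono hsub (hL.subset_root _ h)).eq_bot_of_self)
        (hL.nonempty _ h).ne_empty
    · exact h
  have cross : ∀ P ∈ SL, ∀ Q ∈ SR, P ∪ Q ∈ insert A (SL ∪ SR) → P = L ∧ Q = R := by
    intro P hP Q hQ h
    have hPL := hL.subset_root P hP
    have hQR := hR.subset_root Q hQ
    rw [Finset.mem_insert, Finset.mem_union] at h
    rcases h with h | h | h
    · have hPQ : P ∪ Q = L ∪ R := h.trans hs.union_eq.symm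
      refine ⟨hPL.antisymm fun x hx => ?_, hQR.antisymm fun x hx => ?_⟩
      · have : x ∈ P ∪ Q := hPQ ▸ Finset.mem_union_left _ hx
        rcases Finset.mem_union.1 this with h | h
        · exact h
        · exact absurd (hQR h) (Finset.disjoint_left.1 hs.disjoint hx)
      · have : x ∈ P ∪ Q := hPQ ▸ Finset.mem_union_right _ hx
        rcases Finset.mem_union.1 this with h | h
        · exact absurd hx (Finset.disjoint_left.1 hs.disjoint (hPL h))
        · exact h
    · obtain ⟨x, hx⟩ := hR.nonempty Q hQ
      exact absurd (hQR hx) (Finset.disjoint_left.1 hs.disjoint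
        (hL.subset_root _ h (Finset.mem_union_right _ hx)))
    · obtain ⟨x, hx⟩ := hL.nonempty P hP
      exact absurd (hR.subset_root _ h (Finset.mem_union_left _ hx))
        (Finset.disjoint_left.1 hs.disjoint (hPL hx))
  have notA : ∀ P ∈ insert A (SL ∪ SR), ¬ Disjoint A P := by
    intro P hP hd
    exact ((node hs hL hR).nonempty P hP).ne_empty
      (hd.symm.eq_bot_of_le ((node hs hL hR).subset_root P hP))
  ext p
  induction p with
  | _ P Q =>
    simp only [Finset.mem_insert, Finset.mem_union, mem_sibs]
    simp only [Finset.mem_insert, Finset.mem_union] at key key' cross notA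
    constructor
    · rintro ⟨⟨hP, hQ⟩, hd, hu⟩
      have hPA : P ≠ A := by
        rintro rfl
        exact notA Q hQ hd
      have hQA : Q ≠ A := by
        rintro rfl
        exact notA P hP hd.symm
      rcases hP.resolve_left hPA with hP | hP <;> rcases hQ.resolve_left hQA with hQ | hQ
      · exact Or.inr (Or.inl ⟨⟨hP, hQ⟩, hd, key P hP Q hQ hu⟩)
      · obtain ⟨rfl, rfl⟩ := cross P hP Q hQ hu
        exact Or.inl rfl
      · rw [Finset.union_comm] at hu
        obtain ⟨rfl, rfl⟩ := cross Q hQ P hP hu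
        exact Or.inl Sym2.eq_swap
      · exact Or.inr (Or.inr ⟨⟨hP, hQ⟩, hd, key' P hP Q hQ hu⟩)
    · have hu := hs.union_eq
      rintro (h | ⟨⟨hP, hQ⟩, hd, hu⟩ | ⟨⟨hP, hQ⟩, hd, hu⟩)
      · rcases Sym2.eq_iff.1 h with ⟨rfl, rfl⟩ | ⟨rfl, rfl⟩
        · exact ⟨⟨Or.inr (Or.inl hL.root_mem), Or.inr (Or.inr hR.root_mem)⟩, hs.disjoint,
            Or.inl hu⟩
        · exact ⟨⟨Or.inr (Or.inr hR.root_mem), Or.inr (Or.inl hL.root_mem)⟩, hs.disjoint.symm,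
            Or.inl (by rw [Finset.union_comm, hu])⟩
      · exact ⟨⟨Or.inr (Or.inl hP), Or.inr (Or.inl hQ)⟩, hd, Or.inr (Or.inl hu)⟩
      · exact ⟨⟨Or.inr (Or.inr hP), Or.inr (Or.inr hQ)⟩, hd, Or.inr (Or.inr hu)⟩

theorem treeHeur_leaf : treeHeur H {A} = H A := by
  simp [treeHeur, lvs_leaf]

theorem treeHeur_node (H : Finset α → ℝ≥0) (hs : T.IsSplit A L R) (hL : PartialTree T L SL)
    (hR : PartialTree T R SR) :
    treeHeur H (insert A (SL ∪ SR)) = treeHeur H SL + treeHeur H SR := by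
  rw [treeHeur, lvs_node hs hL hR, Finset.sum_union (disjoint_lvs hs hL hR)]
  rfl

theorem treeCost_leaf (hA : A.Nonempty) : treeCost ψ {A} = 0 := by
  simp [treeCost, sibs_leaf hA]

theorem treeCost_node (ψ : Sym2 (Finset α) → ℝ≥0) (hs : T.IsSplit A L R)
    (hL : PartialTree T L SL) (hR : PartialTree T R SR) :
    treeCost ψ (insert A (SL ∪ SR)) = ψ s(L, R) + treeCost ψ SL + treeCost ψ SR := by
  have hd := disjoint_branches hs hL hR
  have h1 : s(L, R) ∉ sibs SL ∪ sibs SR := by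
    rw [Finset.mem_union, mem_sibs, mem_sibs]
    rintro (⟨⟨-, h⟩, -⟩ | ⟨⟨h, -⟩, -⟩)
    · exact Finset.disjoint_left.1 hd h hR.root_mem
    · exact Finset.disjoint_left.1 hd hL.root_mem h
  have h2 : Disjoint (sibs SL) (sibs SR) := by
    rw [Finset.disjoint_left]
    intro p
    induction p with
    | _ P Q =>
      rw [mem_sibs, mem_sibs]
      exact fun h h' => Finset.disjoint_left.1 hd h.1.1 h'.1.1
  rw [treeCost, sibs_node hs hL hR, Finset.sum_insert h1, Finset.sum_union h2, ← add_assoc]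
  rfl

theorem fval_leaf (hA : A.Nonempty) : fval ψ H {A} = H A := by
  rw [fval, treeCost_leaf hA, treeHeur_leaf, zero_add]

theorem fval_node (ψ : Sym2 (Finset α) → ℝ≥0) (H : Finset α → ℝ≥0) (hs : T.IsSplit A L R)
    (hL : PartialTree T L SL) (hR : PartialTree T R SR) :
    fval ψ H (insert A (SL ∪ SR)) = ψ s(L, R) + fval ψ H SL + fval ψ H SR := by
  rw [fval, treeCost_node ψ hs hL hR, treeHeur_node H hs hL hR, fval, fval]
  ring

/-- A node that is not a leaf has a pair of children in the tree. -/
theorem exists_isSplit (h : PartialTree T A S) :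
    ∀ B ∈ S, B ∉ lvs S → ∃ L ∈ S, ∃ R ∈ S, T.IsSplit B L R := by
  induction h with
  | leaf => simp [lvs_leaf]
  | @node A L R SL SR hs hL hR ihL ihR =>
    intro B hB hBl
    rw [lvs_node hs hL hR, Finset.mem_union, not_or] at hBl
    rw [Finset.mem_insert, Finset.mem_union] at hB
    simp only [Finset.mem_insert, Finset.mem_union]
    rcases hB with rfl | hB | hB
    · exact ⟨L, Or.inr (Or.inl hL.root_mem), R, Or.inr (Or.inr hR.root_mem), hs⟩
    · obtain ⟨L', hL', R', hR', h⟩ := ihL B hB hBl.1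
      exact ⟨L', Or.inr (Or.inl hL'), R', Or.inr (Or.inl hR'), h⟩
    · obtain ⟨L', hL', R', hR', h⟩ := ihR B hB hBl.2
      exact ⟨L', Or.inr (Or.inr hL'), R', Or.inr (Or.inr hR'), h⟩

/-- A cluster of the trellis is the root of a complete tree. -/
theorem exists_complete_of_mem (T : Trellis α) (n : ℕ) :
    ∀ A ∈ T.clusters, A.Nonempty → A.card = n →
      ∃ S, PartialTree T A S ∧ ∀ B ∈ lvs S, B.card = 1 := by
  induction n using Nat.strong_induction_on with
  | _ n ih =>
    rintro A hA hne rfl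
    rcases (Nat.succ_le_of_lt (Finset.card_pos.2 hne)).eq_or_lt with h | h
    · exact ⟨{A}, leaf hA hne, by simpa [lvs_leaf] using h.symm⟩
    · obtain ⟨L, R, hs⟩ := T.exists_isSplit hA h
      obtain ⟨SL, hL, hL'⟩ := ih _ (Finset.card_lt_card hs.left_ssubset) L hs.left_mem
        hs.left_nonempty rfl
      obtain ⟨SR, hR, hR'⟩ := ih _ (Finset.card_lt_card hs.right_ssubset) R hs.right_mem
        hs.right_nonempty rfl
      refine ⟨_, node hs hL hR, fun B hB => ?_⟩
      rw [lvs_node hs hL hR, Finset.mem_union] at hB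
      exact hB.elim (hL' B) (hR' B)

/-- Every partial tree is part of a complete tree. -/
theorem exists_complete (h : PartialTree T A S) :
    ∃ K, S ⊆ K ∧ PartialTree T A K ∧ ∀ B ∈ lvs K, B.card = 1 := by
  induction h with
  | leaf hA hne =>
    obtain ⟨K, hK, h1⟩ := exists_complete_of_mem T _ _ hA hne rfl
    exact ⟨K, Finset.singleton_subset_iff.2 hK.root_mem, hK, h1⟩
  | node hs hL hR ihL ihR =>
    obtain ⟨KL, hSL, hKL, hL1⟩ := ihL
    obtain ⟨KR, hSR, hKR, hR1⟩ := ihR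
    refine ⟨_, Finset.insert_subset_insert _ (Finset.union_subset_union hSL hSR),
      node hs hKL hKR, fun B hB => ?_⟩
    rw [lvs_node hs hKL hKR, Finset.mem_union] at hB
    exact hB.elim (hL1 B) (hR1 B)

/-- Splitting a leaf `B` of a partial tree into `L, R` gives a partial tree; `f` changes by the
cost of the pair and the heuristic values of the clusters involved, and the other leaves stay. -/
theorem split_leaf (h : PartialTree T A S) (hB : B ∈ lvs S) (hs : T.IsSplit B L R) :
    PartialTree T A (S ∪ {L, R}) ∧
      fval ψ H (S ∪ {L, R}) + H B = fval ψ H S + (ψ s(L, R) + H L + H R) ∧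
      ∀ C, C ∈ lvs (S ∪ {L, R}) ↔ C = L ∨ C = R ∨ C ∈ lvs S ∧ C ≠ B := by
  induction h with
  | @leaf A hA hne =>
    obtain rfl : B = A := by simpa [lvs_leaf] using hB
    have hL : PartialTree T L {L} := leaf hs.left_mem hs.left_nonempty
    have hR : PartialTree T R {R} := leaf hs.right_mem hs.right_nonempty
    have e : ({B} ∪ {L, R} : Finset (Finset α)) = insert B ({L} ∪ {R}) := rfl
    rw [e]
    refine ⟨node hs hL hR, ?_, fun C => ?_⟩
    · rw [fval_node ψ H hs hL hR, fval_leaf hs.left_nonempty, fval_leaf hs.right_nonempty,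
        fval_leaf hne]
      ring
    · rw [lvs_node hs hL hR, lvs_leaf, lvs_leaf, lvs_leaf]
      simp only [Finset.mem_union, Finset.mem_singleton]
      tauto
  | @node A L₀ R₀ SL SR hs₀ hL hR ihL ihR =>
    have hdl := disjoint_lvs hs₀ hL hR
    rw [lvs_node hs₀ hL hR, Finset.mem_union] at hB
    rcases hB with hB | hB
    · obtain ⟨h1, h2, h3⟩ := ihL hB
      have e : insert A (SL ∪ SR) ∪ {L, R} = insert A ((SL ∪ {L, R}) ∪ SR) := by
        rw [Finset.insert_union, Finset.union_right_comm]
      have hne : ∀ C ∈ lvs SR, C ≠ B := by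
        rintro _ h rfl
        exact Finset.disjoint_left.1 hdl hB h
      rw [e]
      refine ⟨node hs₀ h1 hR, ?_, fun C => ?_⟩
      · rw [fval_node ψ H hs₀ h1 hR, fval_node ψ H hs₀ hL hR]
        linear_combination h2
      · have := hne C
        rw [lvs_node hs₀ h1 hR, lvs_node hs₀ hL hR, Finset.mem_union, h3, Finset.mem_union]
        rw [or_and_right, and_iff_left_of_imp this]
        simp only [or_assoc]
    · obtain ⟨h1, h2, h3⟩ := ihR hB
      have e : insert A (SL ∪ SR) ∪ {L, R} = insert A (SL ∪ (SR ∪ {L, R})) := by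
        rw [Finset.insert_union, Finset.union_assoc]
      have hne : ∀ C ∈ lvs SL, C ≠ B := by
        rintro _ h rfl
        exact Finset.disjoint_left.1 hdl h hB
      rw [e]
      refine ⟨node hs₀ hL h1, ?_, fun C => ?_⟩
      · rw [fval_node ψ H hs₀ hL h1, fval_node ψ H hs₀ hL hR]
        linear_combination h2
      · have := hne C
        rw [lvs_node hs₀ hL h1, lvs_node hs₀ hL hR, Finset.mem_union, h3, Finset.mem_union]
        rw [or_and_right, and_iff_left_of_imp this]
        simp only [or_left_comm]

/-- The leaves of a partial tree partition its root. -/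
theorem sum_card_lvs (h : PartialTree T A S) : ∑ B ∈ lvs S, B.card = A.card := by
  induction h with
  | leaf => simp [lvs_leaf]
  | node hs hL hR ihL ihR =>
    rw [lvs_node hs hL hR, Finset.sum_union (disjoint_lvs hs hL hR), ihL, ihR,
      ← Finset.card_union_of_disjoint hs.disjoint, hs.union_eq]

end PartialTree

/-! ### Search states as partial trees -/

namespace IsHierarchicalClustering

/-- In a hierarchical clustering there is nothing between a cluster and its two children. -/
theorem subset_child (hK : IsHierarchicalClustering K) (hL : L ∈ K) (hR : R ∈ K)
    (hs : T.IsSplit A L R) (hB : B ∈ K) (hBA : B ⊆ A) : B = A ∨ B ⊆ L ∨ B ⊆ R := by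
  have hcov : ∀ x ∈ B, x ∈ L ∨ x ∈ R := fun x hx =>
    Finset.mem_union.1 (hs.union_eq ▸ hBA hx)
  rcases hK.nested B hB L hL with h | h | h
  · exact Or.inr (Or.inl h)
  · rcases hK.nested B hB R hR with h' | h' | h'
    · exact Or.inr (Or.inr h')
    · exact Or.inl (hBA.antisymm (hs.union_eq ▸ Finset.union_subset h h'))
    · exact Or.inr (Or.inl fun x hx =>
        (hcov x hx).resolve_right (Finset.disjoint_left.1 h' hx))
  · exact Or.inr (Or.inr fun x hx => (hcov x hx).resolve_left (Finset.disjoint_left.1 h hx))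

theorem ssubset_child (hK : IsHierarchicalClustering K) (hL : L ∈ K) (hR : R ∈ K)
    (hs : T.IsSplit A L R) (hB : B ∈ K) (hBA : B ⊂ A) : B ⊆ L ∨ B ⊆ R :=
  (hK.subset_child hL hR hs hB hBA.1).resolve_left hBA.ne

/-- In a hierarchical clustering every cluster above a child is above the parent. -/
theorem subset_of_child_ssubset (hK : IsHierarchicalClustering K) (hA : A ∈ K) (hL : L ∈ K)
    (hR : R ∈ K) (hs : T.IsSplit A L R) (hC : C ∈ K) (hLC : L ⊂ C) : A ⊆ C := by
  obtain ⟨x, hx⟩ := hs.left_nonempty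
  rcases hK.nested C hC A hA with h | h | h
  · rcases hK.subset_child hL hR hs hC h with rfl | h | h
    · exact subset_rfl
    · exact absurd h hLC.2
    · exact absurd (h (hLC.1 hx)) (Finset.disjoint_left.1 hs.disjoint hx)
  · exact h
  · exact absurd (hs.left_subset hx) (Finset.disjoint_left.1 h (hLC.1 hx))

/-- In a hierarchical clustering the children of a cluster are unique. -/
theorem children_unique (hK : IsHierarchicalClustering K) (hL : L ∈ K) (hR : R ∈ K)
    (hs : T.IsSplit A L R) {L' R' : Finset α} (hL' : L' ∈ K) (hR' : R' ∈ K)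
    (hs' : T.IsSplit A L' R') : ({L', R'} : Finset (Finset α)) = {L, R} := by
  -- Two clusters with union `L ∪ R` that lie below `L` and `R` respectively are `L` and `R`.
  have key : ∀ {P Q L R : Finset α}, T.IsSplit A P Q → T.IsSplit A L R → P ⊆ L → Q ⊆ R →
      P = L := by
    intro P Q L R h h' hP hQ
    refine hP.antisymm fun x hx => ?_
    have : x ∈ P ∪ Q := by
      rw [h.union_eq]
      exact h'.left_subset hx
    exact (Finset.mem_union.1 this).resolve_right fun hxQ =>
      Finset.disjoint_left.1 h'.disjoint hx (hQ hxQ)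
  have not_both : ∀ {P Q L R : Finset α}, T.IsSplit A P Q → T.IsSplit A L R → P ⊆ L → ¬ Q ⊆ L := by
    intro P Q L R h h' hP hQ
    exact h'.left_ssubset.2 (h.union_eq ▸ Finset.union_subset hP hQ)
  rcases hK.ssubset_child hL hR hs hL' hs'.left_ssubset with h1 | h1 <;>
    rcases hK.ssubset_child hL hR hs hR' hs'.right_ssubset with h2 | h2
  · exact absurd h2 (not_both hs' hs h1)
  · rw [key hs' hs h1 h2, key hs'.symm hs.symm h2 h1]
  · rw [key hs' hs.symm h1 h2, key hs'.symm hs h2 h1, Finset.pair_comm]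
  · exact absurd h2 (not_both hs' hs.symm h1)

theorem nonempty (hK : IsHierarchicalClustering K) (hA : A ∈ K) : A.Nonempty := by
  rw [Finset.nonempty_iff_ne_empty]
  rintro rfl
  exact hK.empty_notMem hA

end IsHierarchicalClustering

theorem PartialTree.exists_leaf_mem (h : PartialTree T A S) {x : α} (hx : x ∈ A) :
    ∃ B ∈ lvs S, x ∈ B := by
  induction h with
  | leaf => exact ⟨_, by rw [lvs_leaf]; exact Finset.mem_singleton_self _, hx⟩
  | node hs hL hR ihL ihR =>
    rw [lvs_node hs hL hR]
    rw [← hs.union_eq, Finset.mem_union] at hx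
    rcases hx with hx | hx
    · obtain ⟨B, hB, hxB⟩ := ihL hx
      exact ⟨B, Finset.mem_union_left _ hB, hxB⟩
    · obtain ⟨B, hB, hxB⟩ := ihR hx
      exact ⟨B, Finset.mem_union_right _ hB, hxB⟩

theorem lvs_subset : lvs S ⊆ S := Finset.filter_subset _ _

/-- A partial tree of the whole dataset without large leaves is a hierarchical clustering. -/
theorem PartialTree.mem_trees (h : PartialTree T Finset.univ S)
    (h1 : ∀ B ∈ lvs S, B.card = 1) : S ∈ T.trees where
  left :=
    { univ_mem := h.root_mem
      singleton_mem := by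
        intro x
        obtain ⟨B, hB, hx⟩ := h.exists_leaf_mem (Finset.mem_univ x)
        obtain ⟨y, rfl⟩ := Finset.card_eq_one.1 (h1 B hB)
        rw [Finset.mem_singleton.1 hx]
        exact lvs_subset hB
      empty_notMem := fun h' => Finset.not_nonempty_empty (h.nonempty _ h')
      nested := h.nested
      binary := by
        intro A hA hc
        obtain ⟨L, hL, R, hR, hs⟩ := h.exists_isSplit A hA fun hl => hc.ne' (h1 A hl)
        exact ⟨L, hL, R, hR, hs.disjoint, hs.union_eq, hs.left_ssubset.ne, hs.right_ssubset.ne⟩ }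
  right := h.mem_clusters

theorem PartialTree.isState (h : PartialTree T Finset.univ S) : T.IsState S := by
  obtain ⟨K, hSK, hK, h1⟩ := h.exists_complete
  exact ⟨⟨K, hK.mem_trees h1, hSK⟩, h.root_mem, h.exists_isSplit⟩

/-- The part of a state below one of its clusters is a partial tree. -/
theorem Trellis.IsState.partialTree_filter (h : T.IsState S) (n : ℕ) :
    ∀ A ∈ S, A.card = n → PartialTree T A (S.filter (· ⊆ A)) := by
  obtain ⟨⟨K, hK, hSK⟩, -, hsplit⟩ := h
  induction n using Nat.strong_induction_on with
  | _ n ih =>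
    rintro A hA rfl
    by_cases hl : A ∈ lvs S
    · have : S.filter (· ⊆ A) = {A} := by
        ext B
        simp only [Finset.mem_filter, Finset.mem_singleton]
        constructor
        · rintro ⟨hB, hBA⟩
          by_contra hne
          exact (mem_lvs.1 hl).2 B hB (hBA.ssubset_of_ne hne)
        · rintro rfl
          exact ⟨hA, subset_rfl⟩
      rw [this]
      exact .leaf (hK.2 (hSK hA)) (hK.1.nonempty (hSK hA))
    · obtain ⟨L, hL, R, hR, hs⟩ := hsplit A hA hl
      have : S.filter (· ⊆ A) = insert A (S.filter (· ⊆ L) ∪ S.filter (· ⊆ R)) := by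
        ext B
        simp only [Finset.mem_filter, Finset.mem_insert, Finset.mem_union]
        constructor
        · rintro ⟨hB, hBA⟩
          rcases hK.1.subset_child (hSK hL) (hSK hR) hs (hSK hB) hBA with h | h | h
          · exact Or.inl h
          · exact Or.inr (Or.inl ⟨hB, h⟩)
          · exact Or.inr (Or.inr ⟨hB, h⟩)
        · rintro (rfl | ⟨hB, h⟩ | ⟨hB, h⟩)
          · exact ⟨hA, subset_rfl⟩
          · exact ⟨hB, h.trans hs.left_subset⟩
          · exact ⟨hB, h.trans hs.right_subset⟩
      rw [this]
      exact .node hs (ih _ (Finset.card_lt_card hs.left_ssubset) L hL rfl)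
        (ih _ (Finset.card_lt_card hs.right_ssubset) R hR rfl)

/-- The search states are the partial trees of the whole dataset. -/
theorem isState_iff : T.IsState S ↔ PartialTree T Finset.univ S := by
  refine ⟨fun h => ?_, PartialTree.isState⟩
  simpa using h.partialTree_filter _ _ h.2.1 rfl

theorem Trellis.IsState.partialTree (h : T.IsState S) : PartialTree T Finset.univ S :=
  isState_iff.1 h

/-! ### Goal states -/

theorem card_eq_one_of_mem_lvs (hS : S ∈ T.trees) (hA : A ∈ lvs S) : A.card = 1 := by
  have hne := hS.1.nonempty (lvs_subset hA)
  by_contra h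
  obtain ⟨L, hL, R, -, -, hu, hLA, -⟩ := hS.1.binary A (lvs_subset hA)
    (by have := Finset.card_pos.2 hne; omega)
  exact (mem_lvs.1 hA).2 L hL ((hu ▸ Finset.subset_union_left).ssubset_of_ne hLA)

theorem isState_of_mem_trees (hS : S ∈ T.trees) : T.IsState S := by
  refine ⟨⟨S, hS, subset_rfl⟩, hS.1.univ_mem, fun A hA hl => ?_⟩
  have : ∃ B ∈ S, B ⊂ A := by
    by_contra! h
    exact hl (mem_lvs.2 ⟨hA, h⟩)
  obtain ⟨B, hB, hBA⟩ := this
  obtain ⟨L, hL, R, hR, hd, hu, -, -⟩ := hS.1.binary A hA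
    ((Nat.succ_le_of_lt (Finset.card_pos.2 (hS.1.nonempty hB))).trans_lt (Finset.card_lt_card hBA))
  exact ⟨L, hL, R, hR, hS.2 hA, hS.2 hL, hS.2 hR, hS.1.nonempty hL, hS.1.nonempty hR, hd, hu⟩

theorem treeHeur_eq_zero (hH : ∀ x : α, H {x} = 0) (hS : S ∈ T.trees) : treeHeur H S = 0 := by
  refine Finset.sum_eq_zero fun A hA => ?_
  obtain ⟨x, rfl⟩ := Finset.card_eq_one.1 (card_eq_one_of_mem_lvs hS hA)
  exact hH x

theorem fval_of_mem_trees (hH : ∀ x : α, H {x} = 0) (hS : S ∈ T.trees) :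
    fval ψ H S = treeCost ψ S := by
  rw [fval, treeHeur_eq_zero hH hS, add_zero]

/-- A state is a goal if and only if it has as many leaves as there are data points. -/
theorem mem_trees_iff_card_lvs (hS : T.IsState S) :
    S ∈ T.trees ↔ (lvs S).card = Fintype.card α := by
  have hsum := hS.partialTree.sum_card_lvs
  rw [Finset.card_univ] at hsum
  have hpos : ∀ B ∈ lvs S, 1 ≤ B.card := fun B hB =>
    Finset.card_pos.2 (hS.partialTree.nonempty B (lvs_subset hB))
  constructor
  · intro h
    rw [← hsum, Finset.card_eq_sum_ones]
    exact Finset.sum_congr rfl fun B hB => (card_eq_one_of_mem_lvs h hB).symm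
  · intro h
    refine hS.partialTree.mem_trees fun B hB => ?_
    rw [← hsum, Finset.card_eq_sum_ones] at h
    exact ((Finset.sum_eq_sum_iff_of_le hpos).1 h B hB).symm

theorem exists_large_leaf (hS : T.IsState S) (h : S ∉ T.trees) : ∃ B ∈ lvs S, 1 < B.card := by
  by_contra! h'
  refine h (hS.partialTree.mem_trees fun B hB => le_antisymm (h' B hB) ?_)
  exact Finset.card_pos.2 (hS.partialTree.nonempty B (lvs_subset hB))

theorem notMem_trees_of_leaf (hB : B ∈ lvs S) (h : 1 < B.card) : S ∉ T.trees :=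
  fun hS => h.ne' (card_eq_one_of_mem_lvs hS hB)

theorem isState_singleton_univ [Nonempty α] (T : Trellis α) : T.IsState {Finset.univ} :=
  (PartialTree.leaf T.univ_mem Finset.univ_nonempty).isState

theorem trees_nonempty [Nonempty α] (T : Trellis α) : T.trees.Nonempty := by
  obtain ⟨⟨K, hK, -⟩, -⟩ := isState_singleton_univ T
  exact ⟨K, hK⟩

/-! ### Edges of the state space -/

theorem Trellis.IsNeighbor.subset (h : T.IsNeighbor S S') : S ⊆ S' := by
  obtain ⟨-, K, -, -, l, r, -, rfl⟩ := h
  rw [Finset.union_assoc]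
  exact Finset.subset_union_left

theorem Trellis.IsNeighbor.ssubset (h : T.IsNeighbor S S') : S ⊂ S' := by
  refine h.subset.ssubset_of_ne ?_
  obtain ⟨-, K, hK, ⟨A, hA⟩, l, r, hs, rfl⟩ := h
  intro h'
  refine (mem_lvs.1 (hK hA)).2 (l A) ?_ (hs A hA).left_ssubset
  rw [h']
  exact Finset.mem_union_left _ (Finset.mem_union_right _ (Finset.mem_image_of_mem l hA))

theorem Trellis.IsNeighbor.isState (h : T.IsNeighbor S S') : T.IsState S' := by
  obtain ⟨hS, K, hK, -, l, r, hs, rfl⟩ := h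
  rw [isState_iff] at hS ⊢
  suffices ∀ K ⊆ lvs S, (∀ A ∈ K, T.IsSplit A (l A) (r A)) →
      PartialTree T Finset.univ (S ∪ K.image l ∪ K.image r) ∧
      ∀ C ∈ lvs S, C ∉ K → C ∈ lvs (S ∪ K.image l ∪ K.image r) from (this K hK hs).1
  intro K
  induction K using Finset.induction_on with
  | empty => simpa using hS
  | insert A K hA ih =>
    intro hK hs
    obtain ⟨h1, h2⟩ := ih ((Finset.subset_insert _ _).trans hK)
      fun B hB => hs B (Finset.mem_insert_of_mem hB)
    obtain ⟨h3, -, h4⟩ := h1.split_leaf (H := 0) (ψ := 0)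
      (h2 A (hK (Finset.mem_insert_self _ _)) hA) (hs A (Finset.mem_insert_self _ _))
    have e : S ∪ (insert A K).image l ∪ (insert A K).image r =
        S ∪ K.image l ∪ K.image r ∪ {l A, r A} := by
      ext B
      simp only [Finset.image_insert, Finset.mem_union, Finset.mem_insert, Finset.mem_singleton]
      tauto
    rw [e]
    refine ⟨h3, fun C hC hCK => ?_⟩
    rw [Finset.mem_insert, not_or] at hCK
    exact (h4 C).2 (Or.inr (Or.inr ⟨h2 C hC hCK.2, hCK.1⟩))

theorem isNeighbor_split (hS : T.IsState S) (hA : A ∈ lvs S) (hs : T.IsSplit A L R) :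
    T.IsNeighbor S (S ∪ {L, R}) := by
  refine ⟨hS, {A}, Finset.singleton_subset_iff.2 hA, Finset.singleton_nonempty A, fun _ => L,
    fun _ => R, by simpa using hs, ?_⟩
  rw [Finset.image_singleton, Finset.image_singleton, Finset.union_assoc]
  rfl

/-- Costs telescope along edges. -/
theorem treeCost_add_cost (h : T.IsNeighbor S S') :
    (treeCost ψ S : ℝ≥0∞) + (T.stateSpace ψ H).cost S S' = treeCost ψ S' := by
  classical
  have : treeCost ψ S' = treeCost ψ S + ∑ p ∈ sibs S' \ sibs S, ψ p := by
    rw [treeCost, treeCost, add_comm, Finset.sum_sdiff (sibs_mono h.subset)]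
  rw [this]
  simp only [Trellis.stateSpace, if_pos h, ENNReal.coe_add]

theorem cost_eq_top (h : ¬ T.IsNeighbor S S') : (T.stateSpace ψ H).cost S S' = ⊤ :=
  if_neg h

theorem cost_ne_top (h : T.IsNeighbor S S') : (T.stateSpace ψ H).cost S S' ≠ ⊤ := by
  simp only [Trellis.stateSpace, if_pos h]
  exact ENNReal.coe_ne_top

/-- Between two nested states there is a state that arises from the smaller one by splitting one
leaf as in the larger one. -/
theorem exists_step {p : Finset (Finset α)} (hp : T.IsState p) (hS : T.IsState S) (h : p ⊂ S) :
    ∃ A ∈ lvs p, A ∈ S ∧ A ∉ lvs S ∧ ∃ L ∈ S, ∃ R ∈ S, T.IsSplit A L R := by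
  obtain ⟨B, hB, hBp⟩ := Finset.exists_of_ssubset h
  -- The smallest cluster of `p` above a missing cluster `B` has not been split in `p`.
  obtain ⟨C, hC, hmin⟩ := Finset.exists_min_image (p.filter (B ⊆ ·)) Finset.card
    ⟨Finset.univ, Finset.mem_filter.2 ⟨hp.2.1, Finset.subset_univ B⟩⟩
  rw [Finset.mem_filter] at hC
  have hBC : B ⊂ C := hC.2.ssubset_of_ne (by rintro rfl; exact hBp hC.1)
  have hCl : C ∉ lvs S := fun h => (mem_lvs.1 h).2 B hB hBC
  refine ⟨C, ?_, h.1 hC.1, hCl, hS.2.2 C (h.1 hC.1) hCl⟩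
  by_contra hCp
  obtain ⟨L, hL, R, hR, hs⟩ := hp.2.2 C hC.1 hCp
  obtain ⟨K, hK, hSK⟩ := hS.1
  rcases hK.1.ssubset_child (hSK (h.1 hL)) (hSK (h.1 hR)) hs (hSK hB) hBC with h' | h'
  · exact (Finset.card_lt_card hs.left_ssubset).not_ge (hmin L (Finset.mem_filter.2 ⟨hL, h'⟩))
  · exact (Finset.card_lt_card hs.right_ssubset).not_ge (hmin R (Finset.mem_filter.2 ⟨hR, h'⟩))

theorem exists_neighbor_subset {p : Finset (Finset α)} (hp : T.IsState p) (hS : T.IsState S)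
    (h : p ⊂ S) : ∃ p' ⊆ S, T.IsNeighbor p p' := by
  obtain ⟨A, hA, -, -, L, hL, R, hR, hs⟩ := exists_step hp hS h
  exact ⟨p ∪ {L, R}, Finset.union_subset h.1 (by simp [Finset.insert_subset_iff, hL, hR]),
    isNeighbor_split hp hA hs⟩

/-- Nested states are joined by a path of edges. -/
theorem reflTransGen_isNeighbor {p : Finset (Finset α)} (hp : T.IsState p) (hS : T.IsState S)
    (h : p ⊆ S) : Relation.ReflTransGen T.IsNeighbor p S := by
  induction hn : S.card - p.card using Nat.strong_induction_on generalizing p with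
  | _ n ih =>
    rcases h.eq_or_ssubset with rfl | h
    · exact .refl
    · obtain ⟨p', hp', hpp'⟩ := exists_neighbor_subset hp hS h
      have h1 := Finset.card_lt_card hpp'.ssubset
      have h2 := Finset.card_le_card hp'
      exact .head hpp' (ih _ (by omega) hpp'.isState hp' rfl)

/-! ### Consistency -/

/-- By consistency `f` does not decrease along an edge. -/
theorem fval_le_of_isNeighbor (hcons : (T.stateSpace ψ H).Consistent) (h : T.IsNeighbor S S') :
    fval ψ H S ≤ fval ψ H S' := by
  have h1 : (treeHeur H S : ℝ≥0∞) ≤ (T.stateSpace ψ H).cost S S' + treeHeur H S' := hcons S S'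
  have h2 := treeCost_add_cost (ψ := ψ) (H := H) h
  rw [← ENNReal.coe_le_coe, fval, fval, ENNReal.coe_add, ENNReal.coe_add, ← h2, add_assoc]
  gcongr

theorem fval_mono (hcons : (T.stateSpace ψ H).Consistent) (hS : T.IsState S)
    (hS' : T.IsState S') (h : S ⊆ S') : fval ψ H S ≤ fval ψ H S' := by
  have := reflTransGen_isNeighbor hS hS' h
  clear h hS hS'
  induction this with
  | refl => exact le_rfl
  | tail _ h ih => exact ih.trans (fval_le_of_isNeighbor hcons h)

/-- `A` is a leaf of some state. -/
def IsReachable (T : Trellis α) (A : Finset α) : Prop :=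
  ∃ S, T.IsState S ∧ A ∈ lvs S

theorem isReachable_univ [Nonempty α] (T : Trellis α) : IsReachable T Finset.univ :=
  ⟨_, isState_singleton_univ T, by rw [PartialTree.lvs_leaf]; exact Finset.mem_singleton_self _⟩

theorem IsReachable.left (h : IsReachable T A) (hs : T.IsSplit A L R) : IsReachable T L := by
  obtain ⟨S, hS, hA⟩ := h
  exact ⟨_, (isNeighbor_split hS hA hs).isState,
    ((hS.partialTree.split_leaf (ψ := 0) (H := 0) hA hs).2.2 L).2 (Or.inl rfl)⟩

theorem IsReachable.right (h : IsReachable T A) (hs : T.IsSplit A L R) : IsReachable T R :=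
  h.left hs.symm

/-- Consistency of the heuristic at a single cluster. -/
theorem heur_le_split (hcons : (T.stateSpace ψ H).Consistent) (h : IsReachable T A)
    (hs : T.IsSplit A L R) : H A ≤ ψ s(L, R) + H L + H R := by
  obtain ⟨S, hS, hA⟩ := h
  have h1 := (hS.partialTree.split_leaf (ψ := ψ) (H := H) hA hs).2.1
  have h2 := fval_le_of_isNeighbor hcons (isNeighbor_split hS hA hs)
  have h3 : fval ψ H S + H A ≤ fval ψ H S + (ψ s(L, R) + H L + H R) := by
    rw [← h1]
    gcongr
  exact le_of_add_le_add_left h3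

theorem heur_le_fval (hcons : (T.stateSpace ψ H).Consistent) (h : PartialTree T A S)
    (hA : IsReachable T A) : H A ≤ fval ψ H S := by
  induction h with
  | leaf _ hne => rw [PartialTree.fval_leaf hne]
  | node hs hL hR ihL ihR =>
    rw [PartialTree.fval_node ψ H hs hL hR]
    refine (heur_le_split hcons hA hs).trans ?_
    gcongr
    · exact ihL (hA.left hs)
    · exact ihR (hA.right hs)

/-! ### The tree that is encoded by the pointers -/

/-- The clusters in `E` are vertices of the trellis that have children. -/
def IsExplorable (T : Trellis α) (E : Finset (Finset α)) : Prop :=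
  ∀ A ∈ E, A ∈ T.clusters ∧ 1 < A.card

/-- The explored clusters of the family `S` are exactly those that are split in `S`. -/
def IsFrontier (E S : Finset (Finset α)) : Prop :=
  ∀ B ∈ S, B ∈ lvs S ↔ B ∉ E

/-- Each cluster in `E` points to a pair of children, and the other clusters to nothing. -/
def IsPointing (T : Trellis α) (E : Finset (Finset α)) (Ξ : Finset α → Finset (Finset α)) :
    Prop :=
  ∀ A, (A ∉ E ∧ Ξ A = ∅) ∨ (A ∈ E ∧ ∃ L R, T.IsSplit A L R ∧ Ξ A = {L, R})

theorem isFrontier_leaf : IsFrontier E {A} ↔ A ∉ E := by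
  simp [IsFrontier, PartialTree.lvs_leaf]

theorem isFrontier_node (hs : T.IsSplit A L R) (hL : PartialTree T L SL)
    (hR : PartialTree T R SR) :
    IsFrontier E (insert A (SL ∪ SR)) ↔ A ∈ E ∧ IsFrontier E SL ∧ IsFrontier E SR := by
  have hd := PartialTree.disjoint_branches hs hL hR
  have hA : A ∉ lvs SL ∪ lvs SR := by
    rw [← PartialTree.lvs_node hs hL hR, mem_lvs]
    exact fun h => h.2 L (Finset.mem_insert_of_mem (Finset.mem_union_left _ hL.root_mem))
      hs.left_ssubset
  have h1 : ∀ B ∈ SL, B ∈ lvs SL ∪ lvs SR ↔ B ∈ lvs SL := by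
    intro B hB
    rw [Finset.mem_union, or_iff_left]
    exact fun h => Finset.disjoint_left.1 hd hB (lvs_subset h)
  have h2 : ∀ B ∈ SR, B ∈ lvs SL ∪ lvs SR ↔ B ∈ lvs SR := by
    intro B hB
    rw [Finset.mem_union, or_iff_right]
    exact fun h => Finset.disjoint_left.1 hd (lvs_subset h) hB
  simp only [IsFrontier, PartialTree.lvs_node hs hL hR, Finset.forall_mem_insert,
    Finset.forall_mem_union, iff_false_left hA, not_not]
  exact and_congr_right' (and_congr (forall₂_congr fun B hB => by rw [h1 B hB])
    (forall₂_congr fun B hB => by rw [h2 B hB]))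

theorem treeOf_of_empty (h : Ξ A = ∅) : treeOf Ξ A = {A} := by
  rw [treeOf_eq, h]
  rfl

theorem treeOf_of_pair (h : Ξ A = {L, R}) :
    treeOf Ξ A = insert A (treeOf Ξ L ∪ treeOf Ξ R) := by
  rw [treeOf_eq, h, Finset.biUnion_insert, Finset.singleton_biUnion]
  rfl

theorem IsPointing.partialTree (hΞ : IsPointing T E Ξ) (n : ℕ) :
    ∀ A ∈ T.clusters, A.Nonempty → A.card = n →
      PartialTree T A (treeOf Ξ A) ∧ IsFrontier E (treeOf Ξ A) := by
  induction n using Nat.strong_induction_on with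
  | _ n ih =>
    rintro A hA hne rfl
    rcases hΞ A with ⟨hAE, h⟩ | ⟨hAE, L, R, hs, h⟩
    · rw [treeOf_of_empty h, isFrontier_leaf]
      exact ⟨.leaf hA hne, hAE⟩
    · rw [treeOf_of_pair h]
      obtain ⟨hL, hL'⟩ := ih _ (Finset.card_lt_card hs.left_ssubset) L hs.left_mem
        hs.left_nonempty rfl
      obtain ⟨hR, hR'⟩ := ih _ (Finset.card_lt_card hs.right_ssubset) R hs.right_mem
        hs.right_nonempty rfl
      exact ⟨.node hs hL hR, (isFrontier_node hs hL hR).2 ⟨hAE, hL', hR'⟩⟩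

/-- The value that the pointers give to a cluster. -/
def ptrVal (ψ : Sym2 (Finset α) → ℝ≥0) (H : Finset α → ℝ≥0) (Ξ : Finset α → Finset (Finset α))
    (A : Finset α) : ℝ≥0 :=
  fval ψ H (treeOf Ξ A)

/-- The first entry of a tuple in a heap. -/
theorem gLR_add_hLR : gLR ψ Ξ L R + hLR H Ξ L R =
    ψ s(L, R) + ptrVal ψ H Ξ L + ptrVal ψ H Ξ R := by
  simp only [gLR, hLR, ptrVal, fval, treeCost, treeHeur]
  ring

theorem IsPointing.ptrVal_of_notMem (hΞ : IsPointing T E Ξ) (hne : A.Nonempty) (hA : A ∉ E) :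
    ptrVal ψ H Ξ A = H A := by
  rcases hΞ A with ⟨-, h⟩ | ⟨h, -⟩
  · rw [ptrVal, treeOf_of_empty h, PartialTree.fval_leaf hne]
  · exact absurd h hA

theorem IsPointing.ptrVal_of_pair (hΞ : IsPointing T E Ξ) (hs : T.IsSplit A L R)
    (h : Ξ A = {L, R}) :
    ptrVal ψ H Ξ A = ψ s(L, R) + ptrVal ψ H Ξ L + ptrVal ψ H Ξ R := by
  rw [ptrVal, treeOf_of_pair h, PartialTree.fval_node ψ H hs
    (hΞ.partialTree _ L hs.left_mem hs.left_nonempty rfl).1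
    (hΞ.partialTree _ R hs.right_mem hs.right_nonempty rfl).1]
  rfl

/-- The pointers of the algorithm are those that satisfy the Bellman inequality. -/
theorem isPointers_iff (hE : IsExplorable T E) :
    IsPointers T ψ H E Ξ ↔ IsPointing T E Ξ ∧ ∀ A ∈ E, ∀ L R, T.IsSplit A L R →
      ptrVal ψ H Ξ A ≤ ψ s(L, R) + ptrVal ψ H Ξ L + ptrVal ψ H Ξ R := by
  constructor
  · intro h
    have hpt : IsPointing T E Ξ := by
      intro A
      rcases h A with ⟨hA, h0⟩ | ⟨_, _, _, L, R, ⟨hA, L', R', hs, he⟩, -, hLR⟩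
      · refine Or.inl ⟨fun hAE => ?_, h0⟩
        obtain ⟨L, R, hs⟩ := T.exists_isSplit (hE A hAE).1 (hE A hAE).2
        exact Set.eq_empty_iff_forall_notMem.1 hA _ ⟨hAE, L, R, hs, rfl⟩
      · simp only [Prod.mk.injEq] at he
        obtain ⟨-, -, -, rfl, rfl⟩ := he
        exact Or.inr ⟨hA, L, R, hs, hLR⟩
    refine ⟨hpt, fun A hA L R hs => ?_⟩
    rcases h A with ⟨h0, -⟩ | ⟨f, _, _, L₀, R₀, ⟨-, L', R', hs', he⟩, hmin, hLR⟩
    · exact absurd ⟨hA, L, R, hs, rfl⟩ (Set.eq_empty_iff_forall_notMem.1 h0 _)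
    · simp only [Prod.mk.injEq] at he
      obtain ⟨hf, -, -, rfl, rfl⟩ := he
      have := hmin _ ⟨hA, L, R, hs, rfl⟩
      rwa [hf, gLR_add_hLR, gLR_add_hLR, ← hpt.ptrVal_of_pair hs' hLR] at this
  · rintro ⟨hpt, hmin⟩ A
    rcases hpt A with ⟨hA, h⟩ | ⟨hA, L, R, hs, h⟩
    · exact Or.inl ⟨Set.eq_empty_iff_forall_notMem.2 fun e he => hA he.1, h⟩
    · refine Or.inr ⟨_, _, _, L, R, ⟨hA, L, R, hs, rfl⟩, ?_, h⟩
      rintro _ ⟨-, L', R', hs', rfl⟩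
      simp only
      rw [gLR_add_hLR, gLR_add_hLR, ← hpt.ptrVal_of_pair hs h]
      exact hmin A hA L' R' hs'

/-- The optimal value of `A` when exactly the clusters in `E` may be, and have to be, split. -/
def optVal (T : Trellis α) (ψ : Sym2 (Finset α) → ℝ≥0) (H : Finset α → ℝ≥0)
    (E : Finset (Finset α)) (A : Finset α) : ℝ≥0 :=
  open Classical in
  if A ∈ E then
    ⨅ p : {p : Finset α × Finset α // T.IsSplit A p.1 p.2},
      (ψ s(p.1.1, p.1.2) + optVal T ψ H E p.1.1 + optVal T ψ H E p.1.2)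
  else H A
termination_by A.card
decreasing_by
  · exact Finset.card_lt_card p.2.left_ssubset
  · exact Finset.card_lt_card p.2.right_ssubset

theorem optVal_le (hA : A ∈ E) (hs : T.IsSplit A L R) :
    optVal T ψ H E A ≤ ψ s(L, R) + optVal T ψ H E L + optVal T ψ H E R := by
  rw [optVal, if_pos hA]
  exact ciInf_le (OrderBot.bddBelow _)
    (⟨(L, R), hs⟩ : {p : Finset α × Finset α // T.IsSplit A p.1 p.2})

theorem exists_optVal_eq (hE : IsExplorable T E) (hA : A ∈ E) :
    ∃ L R, T.IsSplit A L R ∧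
      optVal T ψ H E A = ψ s(L, R) + optVal T ψ H E L + optVal T ψ H E R := by
  obtain ⟨L, R, hs⟩ := T.exists_isSplit (hE A hA).1 (hE A hA).2
  have : Nonempty {p : Finset α × Finset α // T.IsSplit A p.1 p.2} := ⟨⟨(L, R), hs⟩⟩
  obtain ⟨p, hp⟩ := exists_eq_ciInf_of_finite
    (f := fun p : {p : Finset α × Finset α // T.IsSplit A p.1 p.2} =>
      ψ s(p.1.1, p.1.2) + optVal T ψ H E p.1.1 + optVal T ψ H E p.1.2)
  refine ⟨_, _, p.2, ?_⟩
  rw [optVal, if_pos hA]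
  exact hp.symm

/-- Pointers exist, and ties can be broken in favour of the splits inside a given family `w`. -/
theorem exists_isPointers (hE : IsExplorable T E) (w : Finset (Finset α)) :
    ∃ Ξ, IsPointers T ψ H E Ξ ∧ ∀ A ∈ E, ∀ L ∈ w, ∀ R ∈ w, T.IsSplit A L R →
      ptrVal ψ H Ξ A = ψ s(L, R) + ptrVal ψ H Ξ L + ptrVal ψ H Ξ R →
      ∃ L' ∈ w, ∃ R' ∈ w, T.IsSplit A L' R' ∧ Ξ A = {L', R'} := by
  let Opt : Finset α → Finset α → Finset α → Prop := fun A L R => T.IsSplit A L R ∧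
    optVal T ψ H E A = ψ s(L, R) + optVal T ψ H E L + optVal T ψ H E R
  have hex : ∀ A, ∃ X : Finset (Finset α), (A ∉ E ∧ X = ∅) ∨ (A ∈ E ∧ ∃ L R, Opt A L R ∧
      X = {L, R} ∧ ((∃ L' ∈ w, ∃ R' ∈ w, Opt A L' R') → L ∈ w ∧ R ∈ w)) := by
    intro A
    by_cases hA : A ∈ E
    · by_cases hw : ∃ L' ∈ w, ∃ R' ∈ w, Opt A L' R'
      · obtain ⟨L, hL, R, hR, h⟩ := hw
        exact ⟨{L, R}, Or.inr ⟨hA, L, R, h, rfl, fun _ => ⟨hL, hR⟩⟩⟩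
      · obtain ⟨L, R, h⟩ := exists_optVal_eq (ψ := ψ) (H := H) hE hA
        exact ⟨{L, R}, Or.inr ⟨hA, L, R, h, rfl, fun h => absurd h hw⟩⟩
    · exact ⟨∅, Or.inl ⟨hA, rfl⟩⟩
  choose Ξ hΞ using hex
  have hpt : IsPointing T E Ξ := by
    intro A
    rcases hΞ A with h | ⟨hA, L, R, h, hX, -⟩
    · exact Or.inl h
    · exact Or.inr ⟨hA, L, R, h.1, hX⟩
  have hval : ∀ n, ∀ A : Finset α, A.Nonempty → A.card = n →
      ptrVal ψ H Ξ A = optVal T ψ H E A := by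
    intro n
    induction n using Nat.strong_induction_on with
    | _ n ih =>
      rintro A hne rfl
      rcases hΞ A with ⟨hA, -⟩ | ⟨hA, L, R, h, hX, -⟩
      · rw [hpt.ptrVal_of_notMem hne hA, optVal, if_neg hA]
      · rw [hpt.ptrVal_of_pair h.1 hX, h.2,
          ih _ (Finset.card_lt_card h.1.left_ssubset) L h.1.left_nonempty rfl,
          ih _ (Finset.card_lt_card h.1.right_ssubset) R h.1.right_nonempty rfl]
  have hval' : ∀ A L R, T.IsSplit A L R → ptrVal ψ H Ξ A = optVal T ψ H E A ∧
      ptrVal ψ H Ξ L = optVal T ψ H E L ∧ ptrVal ψ H Ξ R = optVal T ψ H E R := fun A L R hs =>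
    ⟨hval _ A (hs.left_nonempty.mono hs.left_subset) rfl, hval _ L hs.left_nonempty rfl,
      hval _ R hs.right_nonempty rfl⟩
  refine ⟨Ξ, (isPointers_iff hE).2 ⟨hpt, fun A hA L R hs => ?_⟩, ?_⟩
  · obtain ⟨h1, h2, h3⟩ := hval' A L R hs
    rw [h1, h2, h3]
    exact optVal_le hA hs
  · intro A hA L hL R hR hs h
    obtain ⟨h1, h2, h3⟩ := hval' A L R hs
    rw [h1, h2, h3] at h
    rcases hΞ A with ⟨hA', -⟩ | ⟨-, L', R', h', hX, hw⟩
    · exact absurd hA hA'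
    · obtain ⟨hL', hR'⟩ := hw ⟨L, hL, R, hR, hs, h⟩
      exact ⟨L', hL', R', hR', h'.1, hX⟩

/-- The pointers encode a search state whose leaves are its unexplored clusters. -/
theorem IsPointers.isState [Nonempty α] (hE : IsExplorable T E) (hΞ : IsPointers T ψ H E Ξ) :
    T.IsState (treeOf Ξ Finset.univ) ∧ IsFrontier E (treeOf Ξ Finset.univ) := by
  rw [isState_iff]
  exact ((isPointers_iff hE).1 hΞ).1.partialTree _ _ T.univ_mem Finset.univ_nonempty rfl

/-- The tree encoded by the pointers has the least `f` among all trees without explored leaves: what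
a competitor splits beyond the explored clusters does not lower its `f`, by consistency. -/
theorem ptrVal_le_fval (hcons : (T.stateSpace ψ H).Consistent) (hE : IsExplorable T E)
    (hΞ : IsPointers T ψ H E Ξ) (h : PartialTree T A S) (hA : IsReachable T A)
    (hl : ∀ B ∈ lvs S, B ∉ E) : ptrVal ψ H Ξ A ≤ fval ψ H S := by
  rw [isPointers_iff hE] at hΞ
  induction h with
  | @leaf A _ hne =>
    rw [PartialTree.fval_leaf hne, hΞ.1.ptrVal_of_notMem hne]
    exact hl A (by simp [PartialTree.lvs_leaf])
  | @node A L R SL SR hs hL hR ihL ihR =>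
    by_cases hAE : A ∈ E
    · rw [PartialTree.lvs_node hs hL hR] at hl
      rw [PartialTree.fval_node ψ H hs hL hR]
      refine (hΞ.2 A hAE L R hs).trans ?_
      gcongr
      · exact ihL (hA.left hs) fun B hB => hl B (Finset.mem_union_left _ hB)
      · exact ihR (hA.right hs) fun B hB => hl B (Finset.mem_union_right _ hB)
    · have hT := PartialTree.node hs hL hR
      rw [hΞ.1.ptrVal_of_notMem (hT.nonempty A hT.root_mem) hAE]
      exact heur_le_fval hcons hT hA

theorem fval_treeOf_le [Nonempty α] (hcons : (T.stateSpace ψ H).Consistent)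
    (hE : IsExplorable T E) (hΞ : IsPointers T ψ H E Ξ) (hS : T.IsState S)
    (hl : ∀ B ∈ lvs S, B ∉ E) : fval ψ H (treeOf Ξ Finset.univ) ≤ fval ψ H S :=
  ptrVal_le_fval hcons hE hΞ hS.partialTree (isReachable_univ T) hl

theorem fval_treeOf_le_of_mem_trees [Nonempty α] (hcons : (T.stateSpace ψ H).Consistent)
    (hE : IsExplorable T E) (hΞ : IsPointers T ψ H E Ξ) (hS : S ∈ T.trees) :
    fval ψ H (treeOf Ξ Finset.univ) ≤ fval ψ H S :=
  fval_treeOf_le hcons hE hΞ (isState_of_mem_trees hS) fun B hB hBE =>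
    (hE B hBE).2.ne' (card_eq_one_of_mem_lvs hS hB)

/-- Ties can be broken such that the algorithm is at any given optimal state of the frontier. -/
theorem exists_isPointers_treeOf_eq [Nonempty α] (hcons : (T.stateSpace ψ H).Consistent)
    (hE : IsExplorable T E) (hw : T.IsState w) (hf : IsFrontier E w)
    (hopt : ∀ Ξ, IsPointers T ψ H E Ξ → fval ψ H w ≤ fval ψ H (treeOf Ξ Finset.univ)) :
    ∃ Ξ, IsPointers T ψ H E Ξ ∧ treeOf Ξ Finset.univ = w := by
  obtain ⟨Ξ, hΞ, hpref⟩ := exists_isPointers (ψ := ψ) (H := H) hE w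
  refine ⟨Ξ, hΞ, ?_⟩
  have hΞ' := (isPointers_iff hE).1 hΞ
  obtain ⟨K, hK, hwK⟩ := hw.1
  -- Each branch of `w` is optimal for its root, so the preferred splits reproduce it.
  have key : ∀ A S, PartialTree T A S → S ⊆ w → IsReachable T A → IsFrontier E S →
      fval ψ H S ≤ ptrVal ψ H Ξ A → treeOf Ξ A = S := by
    intro A S h
    induction h with
    | @leaf A _ _ =>
      intro _ _ hA _
      rw [isFrontier_leaf] at hA
      rcases hΞ'.1 A with ⟨-, h⟩ | ⟨h, -⟩
      · exact treeOf_of_empty h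
      · exact absurd h hA
    | @node A L R SL SR hs hL hR ihL ihR =>
      intro hSw hA hfr hle
      rw [isFrontier_node hs hL hR] at hfr
      obtain ⟨hAE, hfL, hfR⟩ := hfr
      have hSLw : SL ⊆ w := fun B hB =>
        hSw (Finset.mem_insert_of_mem (Finset.mem_union_left _ hB))
      have hSRw : SR ⊆ w := fun B hB =>
        hSw (Finset.mem_insert_of_mem (Finset.mem_union_right _ hB))
      rw [PartialTree.fval_node ψ H hs hL hR] at hle
      have h1 := ptrVal_le_fval hcons hE hΞ hL (hA.left hs)
        fun B hB => (hfL B (lvs_subset hB)).1 hB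
      have h2 := ptrVal_le_fval hcons hE hΞ hR (hA.right hs)
        fun B hB => (hfR B (lvs_subset hB)).1 hB
      have h3 := hΞ'.2 A hAE L R hs
      have h4 : fval ψ H SL ≤ ptrVal ψ H Ξ L := by
        by_contra! hlt
        refine (h3.trans_lt ?_).not_ge hle
        exact add_lt_add_of_lt_of_le (add_lt_add_right hlt _) h2
      have h5 : fval ψ H SR ≤ ptrVal ψ H Ξ R := by
        by_contra! hlt
        refine (h3.trans_lt ?_).not_ge hle
        exact add_lt_add_of_le_of_lt (add_le_add_right h1 _) hlt
      have hLw := hSLw hL.root_mem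
      have hRw := hSRw hR.root_mem
      obtain ⟨L', hL', R', hR', hs', hX⟩ := hpref A hAE L hLw R hRw hs
        (h3.antisymm (le_trans (by gcongr) hle))
      rw [hK.1.children_unique (hwK hLw) (hwK hRw) hs (hwK hL') (hwK hR') hs'] at hX
      rw [treeOf_of_pair hX, ihL hSLw (hA.left hs) hfL h4, ihR hSRw (hA.right hs) hfR h5]
  exact key _ _ hw.partialTree subset_rfl (isReachable_univ T) hf (hopt Ξ hΞ)

/-! ### Runs of the algorithm on the trellis -/

theorem atGoal_iff (hH : ∀ x : α, H {x} = 0) (hS : T.IsState (treeOf Ξ Finset.univ)) :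
    AtGoal H Ξ ↔ treeOf Ξ Finset.univ ∈ T.trees := by
  rw [AtGoal, mem_trees_iff_card_lvs hS, and_iff_right_of_imp]
  exact fun h => treeHeur_eq_zero hH ((mem_trees_iff_card_lvs hS).2 h)

namespace TrellisRun

variable [Nonempty α]

theorem isExplorable (h : TrellisRun T ψ H E tr) : IsExplorable T E := by
  induction h with
  | initial => simp [IsExplorable]
  | @explore E tr Ξ _ hΞ _ ih =>
    intro A hA
    rw [Finset.mem_union, Finset.mem_filter] at hA
    rcases hA with hA | ⟨hA, hc⟩
    · exact ih A hA
    · exact ⟨(hΞ.isState ih).1.partialTree.mem_clusters A (lvs_subset hA), hc⟩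

/-- What an exploring pass leaves behind: all large clusters of its state are explored, and one of
them is a leaf. -/
theorem explored (hH : ∀ x : α, H {x} = 0) (h : TrellisRun T ψ H E tr) :
    ∀ S ∈ tr, T.IsState S ∧ (∃ A ∈ lvs S, A ∈ E) ∧ ∀ A ∈ S, 1 < A.card → A ∈ E := by
  induction h with
  | initial => simp
  | @explore E tr Ξ hrun hΞ hg ih =>
    intro S hS
    rw [List.mem_append, List.mem_singleton] at hS
    rcases hS with hS | rfl
    · obtain ⟨h1, ⟨A, hA, hAE⟩, h2⟩ := ih S hS
      exact ⟨h1, ⟨A, hA, Finset.mem_union_left _ hAE⟩,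
        fun A hA hc => Finset.mem_union_left _ (h2 A hA hc)⟩
    · obtain ⟨hS, hf⟩ := hΞ.isState hrun.isExplorable
      rw [atGoal_iff hH hS] at hg
      obtain ⟨A, hA, hc⟩ := exists_large_leaf hS hg
      refine ⟨hS, ⟨A, hA, Finset.mem_union_right _ (Finset.mem_filter.2 ⟨hA, hc⟩)⟩,
        fun B hB hc => ?_⟩
      by_cases hBl : B ∈ lvs (treeOf Ξ Finset.univ)
      · exact Finset.mem_union_right _ (Finset.mem_filter.2 ⟨hBl, hc⟩)
      · exact Finset.mem_union_left _ (not_not.1 fun h => hBl ((hf B hB).2 h))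

theorem nodup (hH : ∀ x : α, H {x} = 0) (h : TrellisRun T ψ H E tr) : tr.Nodup := by
  induction h with
  | initial => exact List.nodup_nil
  | @explore E tr Ξ hrun hΞ hg ih =>
    refine ih.append (List.nodup_singleton _) ?_
    rw [List.disjoint_singleton]
    intro hmem
    obtain ⟨-, ⟨A, hA, hAE⟩, -⟩ := hrun.explored hH _ hmem
    exact ((hΞ.isState hrun.isExplorable).2 A (lvs_subset hA)).1 hA hAE

/-- Each exploring pass explores a new cluster. -/
theorem length_le_card (hH : ∀ x : α, H {x} = 0) (h : TrellisRun T ψ H E tr) :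
    tr.length ≤ E.card := by
  induction h with
  | initial => simp
  | @explore E tr Ξ hrun hΞ hg ih =>
    obtain ⟨hS, hf⟩ := hΞ.isState hrun.isExplorable
    rw [atGoal_iff hH hS] at hg
    obtain ⟨A, hA, hc⟩ := exists_large_leaf hS hg
    rw [List.length_append, List.length_singleton]
    refine (Nat.succ_le_succ ih).trans (Nat.succ_le_of_lt (Finset.card_lt_card ?_))
    rw [Finset.ssubset_iff_of_subset Finset.subset_union_left]
    exact ⟨A, Finset.mem_union_right _ (Finset.mem_filter.2 ⟨hA, hc⟩),
      (hf A (lvs_subset hA)).1 hA⟩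

theorem length_le (hH : ∀ x : α, H {x} = 0) (h : TrellisRun T ψ H E tr) :
    tr.length ≤ T.clusters.card :=
  (h.length_le_card hH).trans (Finset.card_le_card fun A hA => (h.isExplorable A hA).1)

end TrellisRun

/-! ### Path costs in the state space -/

section Nonempty

variable [Nonempty α]

/-- All paths from the start to a state have the same cost, the cost of the state. -/
theorem pathCost_eq {a : ℝ≥0∞}
    (h : (T.stateSpace ψ H).PathCost (T.stateSpace ψ H).start S a) :
    a = ⊤ ∨ a = treeCost ψ S := by
  induction h with
  | refl =>
    refine Or.inr ?_
    change 0 = ((treeCost ψ {Finset.univ} : ℝ≥0) : ℝ≥0∞)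
    rw [PartialTree.treeCost_leaf Finset.univ_nonempty, ENNReal.coe_zero]
  | @step v w a _ ih =>
    by_cases hvw : T.IsNeighbor v w
    · rcases ih with rfl | rfl
      · exact Or.inl (top_add _)
      · exact Or.inr (treeCost_add_cost hvw)
    · exact Or.inl (by rw [cost_eq_top hvw, add_top])

theorem reflTransGen_start (hS : T.IsState S) :
    Relation.ReflTransGen T.IsNeighbor {Finset.univ} S :=
  reflTransGen_isNeighbor (isState_singleton_univ T) hS (Finset.singleton_subset_iff.2 hS.2.1)

theorem pathCost_treeCost (ψ : Sym2 (Finset α) → ℝ≥0) (H : Finset α → ℝ≥0) (hS : T.IsState S) :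
    (T.stateSpace ψ H).PathCost (T.stateSpace ψ H).start S (treeCost ψ S) := by
  obtain ⟨a, ha, hp⟩ := SearchProblem.exists_pathCost (P := T.stateSpace ψ H)
    (fun _ _ => cost_ne_top) (reflTransGen_start hS)
  rwa [(pathCost_eq hp).resolve_left ha] at hp

theorem optCost_le_treeCost (hS : S ∈ T.trees) : (T.stateSpace ψ H).optCost ≤ treeCost ψ S :=
  SearchProblem.optCost_le hS (pathCost_treeCost ψ H (isState_of_mem_trees hS))

theorem le_optCost {x : ℝ≥0∞} (h : ∀ S ∈ T.trees, x ≤ treeCost ψ S) :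
    x ≤ (T.stateSpace ψ H).optCost := by
  refine le_sInf ?_
  rintro a ⟨t, ht, hp⟩
  rcases pathCost_eq hp with rfl | rfl
  · exact le_top
  · exact h t ht

theorem optCost_ne_top : (T.stateSpace ψ H).optCost ≠ ⊤ := by
  obtain ⟨K, hK⟩ := trees_nonempty T
  exact ne_top_of_le_ne_top ENNReal.coe_ne_top (optCost_le_treeCost hK)

/-- The `f` value of the state that the algorithm is at is a lower bound for the optimal cost. -/
theorem fval_treeOf_le_optCost (hH : ∀ x : α, H {x} = 0)
    (hcons : (T.stateSpace ψ H).Consistent) (hE : IsExplorable T E)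
    (hΞ : IsPointers T ψ H E Ξ) :
    (fval ψ H (treeOf Ξ Finset.univ) : ℝ≥0∞) ≤ (T.stateSpace ψ H).optCost := by
  refine le_optCost fun S hS => ?_
  rw [ENNReal.coe_le_coe, ← fval_of_mem_trees hH hS]
  exact fval_treeOf_le_of_mem_trees hcons hE hΞ hS

theorem fval_le_optCost_of_mem_run (hH : ∀ x : α, H {x} = 0)
    (hcons : (T.stateSpace ψ H).Consistent) (h : TrellisRun T ψ H E tr) :
    ∀ S ∈ tr, (fval ψ H S : ℝ≥0∞) ≤ (T.stateSpace ψ H).optCost := by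
  induction h with
  | initial => simp
  | explore hrun hΞ _ ih =>
    intro S hS
    rw [List.mem_append, List.mem_singleton] at hS
    rcases hS with hS | rfl
    · exact ih S hS
    · exact fval_treeOf_le_optCost hH hcons hrun.isExplorable hΞ

end Nonempty

/-! ### Simulation of A* on the state space -/

/-- In a run of A* on the state space the `g` value of each generated state is its cost, and the
open states are the generated states that have not been expanded: no state is ever reopened. -/
structure AStarInvariant (T : Trellis α) (ψ : Sym2 (Finset α) → ℝ≥0)
    (l : List (Finset (Finset α))) (c : AStarConfig (Finset (Finset α))) : Prop where
  g_eq : ∀ w, c.g w ≠ ⊤ → c.g w = treeCost ψ w ∧ T.IsState w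
  opened_iff : ∀ w, w ∈ c.opened ↔ c.g w ≠ ⊤ ∧ w ∉ l
  g_expanded : ∀ v ∈ l, c.g v ≠ ⊤
  g_neighbor : ∀ v ∈ l, ∀ w, T.IsNeighbor v w → c.g w ≠ ⊤
  g_start : c.g {Finset.univ} ≠ ⊤
  nodup : l.Nodup

/-- A maximal generated substate of an unexpanded state is open: after its expansion a larger one
would be generated. -/
theorem AStarInvariant.exists_open_subset {l : List (Finset (Finset α))}
    {c : AStarConfig (Finset (Finset α))} (h : AStarInvariant T ψ l c) (hS : T.IsState S)
    (hSl : S ∉ l) : ∃ p ∈ c.opened, p ⊆ S := by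
  classical
  obtain ⟨p, hp, hmax⟩ := Finset.exists_max_image
    (Finset.univ.filter fun p => c.g p ≠ ⊤ ∧ p ⊆ S) Finset.card
    ⟨{Finset.univ}, by simpa using ⟨h.g_start, hS.2.1⟩⟩
  simp only [Finset.mem_filter, Finset.mem_univ, true_and] at hp hmax
  refine ⟨p, (h.opened_iff p).2 ⟨hp.1, fun hpl => ?_⟩, hp.2⟩
  have hpS : p ⊂ S := hp.2.ssubset_of_ne (by rintro rfl; exact hSl hpl)
  obtain ⟨p', hp'S, hpp'⟩ := exists_neighbor_subset (h.g_eq p hp.1).2 hS hpS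
  exact (Finset.card_lt_card hpp'.ssubset).not_ge
    (hmax p' ⟨h.g_neighbor p hpl p' hpp', hp'S⟩)

section Nonempty

variable [Nonempty α]

theorem AStarRun.invariant {l : List (Finset (Finset α))} {c : AStarConfig (Finset (Finset α))}
    (h : AStarRun (T.stateSpace ψ H) l c) : AStarInvariant T ψ l c := by
  induction h with
  | initial =>
    have hg : ∀ w, (AStarConfig.initial (T.stateSpace ψ H)).g w ≠ ⊤ ↔ w = {Finset.univ} := by
      intro w
      simp [AStarConfig.initial, Trellis.stateSpace]
    refine ⟨fun w hw => ?_, fun w => ?_, by simp, by simp, (hg _).2 rfl, List.nodup_nil⟩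
    · obtain rfl := (hg w).1 hw
      refine ⟨?_, isState_singleton_univ T⟩
      rw [PartialTree.treeCost_leaf Finset.univ_nonempty]
      simp [AStarConfig.initial, Trellis.stateSpace]
    · rw [hg]
      simp [AStarConfig.initial, Trellis.stateSpace]
  | @expand l c v _ hsel _ ih =>
    obtain ⟨hgv, hvl⟩ := (ih.opened_iff v).1 hsel.1
    obtain ⟨hgv', -⟩ := ih.g_eq v hgv
    have hnew : ∀ w, T.IsNeighbor v w → c.g v + (T.stateSpace ψ H).cost v w = treeCost ψ w := by
      intro w hvw
      rw [hgv', treeCost_add_cost hvw]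
    have htop : ∀ w, ¬ T.IsNeighbor v w → c.g v + (T.stateSpace ψ H).cost v w = ⊤ := by
      intro w hvw
      rw [cost_eq_top hvw, add_top]
    -- An edge from `v` improves `g` only at a state that is generated for the first time.
    have hlt : ∀ w, c.g v + (T.stateSpace ψ H).cost v w < c.g w ↔
        c.g w = ⊤ ∧ T.IsNeighbor v w := by
      intro w
      by_cases hvw : T.IsNeighbor v w
      · rw [hnew w hvw]
        by_cases hw : c.g w = ⊤
        · simp [hw, hvw]
        · simp [(ih.g_eq w hw).1]
      · simp [htop w hvw, hvw]
    have hg : ∀ w, (c.expand (T.stateSpace ψ H) v).g w ≠ ⊤ ↔ c.g w ≠ ⊤ ∨ T.IsNeighbor v w := by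
      intro w
      by_cases hvw : T.IsNeighbor v w
      · simp [AStarConfig.expand, hnew w hvw, hvw]
      · simp [AStarConfig.expand, htop w hvw, hvw]
    refine ⟨fun w hw => ?_, fun w => ?_, fun u hu => ?_, fun u hu w huw => ?_,
      (hg _).2 (Or.inl ih.g_start), ?_⟩
    · by_cases hvw : T.IsNeighbor v w
      · refine ⟨?_, hvw.isState⟩
        simp only [AStarConfig.expand, hnew w hvw]
        by_cases hcw : c.g w = ⊤
        · simp [hcw]
        · rw [(ih.g_eq w hcw).1, min_self]
      · have hcw := ((hg w).1 hw).resolve_right hvw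
        refine ⟨?_, (ih.g_eq w hcw).2⟩
        simp only [AStarConfig.expand, htop w hvw, min_top_right]
        exact (ih.g_eq w hcw).1
    · rw [hg, List.mem_append, List.mem_singleton]
      change (w ∈ c.opened ∧ w ≠ v) ∨ _ < _ ↔ _
      rw [hlt, ih.opened_iff]
      have h1 : c.g w = ⊤ → w ∉ l ∧ w ≠ v := by
        intro hw
        refine ⟨fun h => ih.g_expanded w h hw, ?_⟩
        rintro rfl
        exact hgv hw
      tauto
    · rw [List.mem_append, List.mem_singleton] at hu
      rcases hu with hu | rfl
      · exact (hg u).2 (Or.inl (ih.g_expanded u hu))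
      · exact (hg u).2 (Or.inl hgv)
    · rw [List.mem_append, List.mem_singleton] at hu
      rcases hu with hu | rfl
      · exact (hg w).2 (Or.inl (ih.g_neighbor u hu w huw))
      · exact (hg w).2 (Or.inr huw)
    · exact ih.nodup.append (List.nodup_singleton _) (List.disjoint_singleton.2 hvl)

/-- A run of A* that has only expanded states with an explored leaf can be continued, expanding
only states with an explored leaf, until it selects the state that the pointers encode. All states
with smaller `f` have an explored leaf, and so have all proper substates of this state. -/
theorem exists_selects (hcons : (T.stateSpace ψ H).Consistent) (hE : IsExplorable T E)
    (hΞ : IsPointers T ψ H E Ξ) (n : ℕ) :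
    ∀ (l : List (Finset (Finset α))) (c : AStarConfig (Finset (Finset α))),
      Fintype.card (Finset (Finset α)) - l.length = n → AStarRun (T.stateSpace ψ H) l c →
      (∀ S ∈ l, ∃ A ∈ lvs S, A ∈ E) →
      ∃ l' c', AStarRun (T.stateSpace ψ H) l' c' ∧ l.Sublist l' ∧
        (∀ S ∈ l', ∃ A ∈ lvs S, A ∈ E) ∧
        c'.Selects (T.stateSpace ψ H) (treeOf Ξ Finset.univ) ∧
        c'.g (treeOf Ξ Finset.univ) = treeCost ψ (treeOf Ξ Finset.univ) := by
  obtain ⟨hS, hf⟩ := hΞ.isState hE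
  set S := treeOf Ξ Finset.univ with hSdef
  induction n using Nat.strong_induction_on with
  | _ n ih =>
    rintro l c rfl hrun hl
    have hinv := hrun.invariant
    have hfval : ∀ w ∈ c.opened, c.g w + (T.stateSpace ψ H).h w = fval ψ H w := by
      intro w hw
      rw [(hinv.g_eq w ((hinv.opened_iff w).1 hw).1).1, fval, ENNReal.coe_add]
      rfl
    by_cases hsel : c.Selects (T.stateSpace ψ H) S
    · exact ⟨l, c, hrun, List.Sublist.refl l, hl, hsel,
        (hinv.g_eq S ((hinv.opened_iff S).1 hsel.1).1).1⟩
    · have hSl : S ∉ l := by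
        intro h
        obtain ⟨A, hA, hAE⟩ := hl S h
        exact (hf A (lvs_subset hA)).1 hA hAE
      obtain ⟨p, hp, hpS⟩ := hinv.exists_open_subset hS hSl
      have hstate : ∀ w ∈ c.opened, T.IsState w := fun w hw =>
        (hinv.g_eq w ((hinv.opened_iff w).1 hw).1).2
      have hpf : fval ψ H p ≤ fval ψ H S := fval_mono hcons (hstate p hp) hS hpS
      -- Either some open state has smaller `f`, or the open substate `p` is itself a minimum.
      obtain ⟨v, hv, hvmin, A, hA, hAE⟩ : ∃ v ∈ c.opened,
          (∀ w ∈ c.opened, fval ψ H v ≤ fval ψ H w) ∧ ∃ A ∈ lvs v, A ∈ E := by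
        by_cases hlt : ∃ w ∈ c.opened, fval ψ H w < fval ψ H S
        · obtain ⟨w, hw, hwS⟩ := hlt
          obtain ⟨v, hv, hmin⟩ := Set.exists_min_image c.opened (fval ψ H) (Set.toFinite _) ⟨w, hw⟩
          refine ⟨v, hv, hmin, ?_⟩
          by_contra! hno
          exact ((hmin w hw).trans_lt hwS).not_ge (fval_treeOf_le hcons hE hΞ (hstate v hv) hno)
        · push Not at hlt
          have hmin : ∀ w ∈ c.opened, fval ψ H p ≤ fval ψ H w := fun w hw =>
            hpf.trans (hlt w hw)
          refine ⟨p, hp, hmin, ?_⟩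
          have hne : p ≠ S := by
            rintro rfl
            refine hsel ⟨hp, fun w hw => ?_⟩
            rw [hfval _ hp, hfval w hw, ENNReal.coe_le_coe]
            exact hmin w hw
          obtain ⟨A, hA, hAS, hAl, -⟩ := exists_step (hstate p hp) hS (hpS.ssubset_of_ne hne)
          exact ⟨A, hA, not_not.1 fun h => hAl ((hf A hAS).2 h)⟩
      have hvg : v ∉ (T.stateSpace ψ H).goal := notMem_trees_of_leaf hA (hE A hAE).2
      have hvsel : c.Selects (T.stateSpace ψ H) v := by
        refine ⟨hv, fun w hw => ?_⟩
        rw [hfval v hv, hfval w hw, ENNReal.coe_le_coe]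
        exact hvmin w hw
      have hrun' := hrun.expand hvsel hvg
      have hlen := hrun'.invariant.nodup.length_le_card
      rw [List.length_append, List.length_singleton] at hlen
      obtain ⟨l', c', h1, h2, h3, h4⟩ := ih _ (by
        rw [List.length_append, List.length_singleton]
        omega) (l ++ [v]) _ rfl hrun' (by
          intro w hw
          rw [List.mem_append, List.mem_singleton] at hw
          rcases hw with hw | rfl
          · exact hl w hw
          · exact ⟨A, hA, hAE⟩)
      exact ⟨l', c', h1, (List.sublist_append_left l [v]).trans h2, h3, h4⟩

/-- Every run of the algorithm is shadowed by a run of A* on the state space. -/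
theorem TrellisRun.exists_aStarRun (hH : ∀ x : α, H {x} = 0)
    (hcons : (T.stateSpace ψ H).Consistent) (h : TrellisRun T ψ H E tr) :
    ∃ l c, AStarRun (T.stateSpace ψ H) l c ∧ tr.Sublist l ∧ ∀ S ∈ l, ∃ A ∈ lvs S, A ∈ E := by
  induction h with
  | initial => exact ⟨[], _, .initial, List.Sublist.refl _, by simp⟩
  | @explore E tr Ξ hrun hΞ hg ih =>
    obtain ⟨l, c, hl, htr, hlE⟩ := ih
    have hS := (hΞ.isState hrun.isExplorable).1
    rw [atGoal_iff hH hS] at hg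
    obtain ⟨l', c', h1, h2, h3, h4, -⟩ :=
      exists_selects hcons hrun.isExplorable hΞ _ l c rfl hl hlE
    refine ⟨_, _, h1.expand h4 hg, (htr.trans h2).append (List.Sublist.refl _), ?_⟩
    intro S hS'
    rw [List.mem_append, List.mem_singleton] at hS'
    rcases hS' with hS' | rfl
    · obtain ⟨A, hA, hAE⟩ := h3 S hS'
      exact ⟨A, hA, Finset.mem_union_left _ hAE⟩
    · obtain ⟨A, hA, hc⟩ := exists_large_leaf hS hg
      exact ⟨A, hA, Finset.mem_union_right _ (Finset.mem_filter.2 ⟨hA, hc⟩)⟩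

end Nonempty

/-! ### Ties -/

/-- The part of the hierarchical clustering `t` that one sees if only the clusters in `E` are
split. -/
def truncate (E t : Finset (Finset α)) : Finset (Finset α) :=
  t.filter fun B => ∀ A ∈ t, B ⊂ A → A ∈ E

theorem mem_truncate : B ∈ truncate E t ↔ B ∈ t ∧ ∀ A ∈ t, B ⊂ A → A ∈ E :=
  Finset.mem_filter

theorem truncate_subset : truncate E t ⊆ t := Finset.filter_subset _ _

theorem truncate_mono (h : E ⊆ E') : truncate E t ⊆ truncate E' t := by
  intro B hB
  rw [mem_truncate] at hB ⊢
  exact ⟨hB.1, fun A hA hBA => h (hB.2 A hA hBA)⟩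

theorem child_mem_truncate (ht : t ∈ T.trees) (hA : A ∈ truncate E t) (hAE : A ∈ E) (hL : L ∈ t)
    (hR : R ∈ t) (hs : T.IsSplit A L R) : L ∈ truncate E t := by
  rw [mem_truncate] at hA ⊢
  refine ⟨hL, fun C hC hLC => ?_⟩
  rcases (ht.1.subset_of_child_ssubset hA.1 hL hR hs hC hLC).eq_or_ssubset with rfl | h
  · exact hAE
  · exact hA.2 C hC h

theorem isFrontier_truncate (hE : IsExplorable T E) (ht : t ∈ T.trees) :
    IsFrontier E (truncate E t) := by
  intro B hB
  constructor
  · intro hBl hBE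
    obtain ⟨L, hL, R, hR, hs⟩ := (isState_of_mem_trees ht).2.2 B (truncate_subset hB)
      fun h => (hE B hBE).2.ne' (card_eq_one_of_mem_lvs ht h)
    exact (mem_lvs.1 hBl).2 L (child_mem_truncate ht hB hBE hL hR hs) hs.left_ssubset
  · exact fun hBE => mem_lvs.2 ⟨hB, fun C hC hCB =>
      hBE ((mem_truncate.1 hC).2 B (truncate_subset hB) hCB)⟩

theorem univ_mem_truncate (ht : t ∈ T.trees) : Finset.univ ∈ truncate E t :=
  mem_truncate.2 ⟨ht.1.univ_mem, fun A _ h => absurd (Finset.subset_univ A) h.2⟩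

theorem isState_truncate (hE : IsExplorable T E) (ht : t ∈ T.trees) :
    T.IsState (truncate E t) := by
  refine ⟨⟨t, ht, truncate_subset⟩, univ_mem_truncate ht, fun A hA hAl => ?_⟩
  have hAE : A ∈ E := not_not.1 fun h => hAl ((isFrontier_truncate hE ht A hA).2 h)
  obtain ⟨L, hL, R, hR, hs⟩ := (isState_of_mem_trees ht).2.2 A (truncate_subset hA)
    fun h => (hE A hAE).2.ne' (card_eq_one_of_mem_lvs ht h)
  exact ⟨L, child_mem_truncate ht hA hAE hL hR hs, R,
    child_mem_truncate ht hA hAE hR hL hs.symm, hs⟩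

/-- The truncations of `t` keep pace with the states on any path to `t`, since all leaves of a
truncation are explored at the same time. -/
theorem subset_truncate_of_isNeighbor (ht : t ∈ T.trees) (h : T.IsNeighbor p p') (hp' : p' ⊆ t)
    (hp : p ⊆ truncate E t) (hE : ∀ A ∈ p, 1 < A.card → A ∈ E) : p' ⊆ truncate E t := by
  obtain ⟨-, K, hK, -, l, r, hs, rfl⟩ := h
  intro B hB
  have hl : ∀ A ∈ K, l A ∈ t := fun A hA => hp'
    (Finset.mem_union_left _ (Finset.mem_union_right _ (Finset.mem_image_of_mem l hA)))
  have hr : ∀ A ∈ K, r A ∈ t := fun A hA => hp'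
    (Finset.mem_union_right _ (Finset.mem_image_of_mem r hA))
  have hKp : ∀ A ∈ K, A ∈ truncate E t ∧ A ∈ E := fun A hA =>
    ⟨hp (lvs_subset (hK hA)), hE A (lvs_subset (hK hA)) (hs A hA).one_lt_card⟩
  rw [Finset.mem_union, Finset.mem_union, Finset.mem_image, Finset.mem_image] at hB
  rcases hB with (hB | ⟨A, hA, rfl⟩) | ⟨A, hA, rfl⟩
  · exact hp hB
  · exact child_mem_truncate ht (hKp A hA).1 (hKp A hA).2 (hl A hA) (hr A hA) (hs A hA)
  · exact child_mem_truncate ht (hKp A hA).1 (hKp A hA).2 (hr A hA) (hl A hA) (hs A hA).symm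

/-- Once the large clusters of the substate `p` of `t` are explored, the states that follow `p` on
a path to `t` are inside the truncation. -/
theorem subset_truncate_of_explored [Nonempty α] (ht : t ∈ T.trees) (h : T.IsNeighbor p p')
    (hp' : p' ⊆ t) (hE : ∀ A ∈ p, 1 < A.card → A ∈ E) : p' ⊆ truncate E t := by
  refine subset_truncate_of_isNeighbor ht h hp' ?_ hE
  have key : ∀ y, Relation.ReflTransGen T.IsNeighbor {Finset.univ} y → y ⊆ p →
      y ⊆ truncate E t := by
    intro y hy
    induction hy with
    | refl => exact fun _ => Finset.singleton_subset_iff.2 (univ_mem_truncate ht)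
    | tail _ hyz ih =>
      intro hz
      have hy := hyz.subset.trans hz
      exact subset_truncate_of_isNeighbor ht hyz (hz.trans (h.subset.trans hp')) (ih hy)
        fun A hA => hE A (hy hA)
  exact key p (reflTransGen_start h.1) subset_rfl

/-- `PathThrough T D t p s`: there is a path of the state space from `p` to `t`, with set of states
`s` (without `t`), and all of these are in `D`. -/
inductive PathThrough (T : Trellis α) (D : Set (Finset (Finset α))) (t : Finset (Finset α)) :
    Finset (Finset α) → Finset (Finset (Finset α)) → Prop
  | refl : PathThrough T D t t ∅
  | step {p p' : Finset (Finset α)} {s : Finset (Finset (Finset α))} :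
      T.IsNeighbor p p' → p ∈ D → PathThrough T D t p' s → PathThrough T D t p (insert p s)

namespace PathThrough

variable {D : Set (Finset (Finset α))} {s : Finset (Finset (Finset α))}

theorem subset (h : PathThrough T D t p s) : p ⊆ t := by
  induction h with
  | refl => exact subset_rfl
  | step h _ _ ih => exact h.subset.trans ih

theorem subset_of_mem (h : PathThrough T D t p s) : ∀ x ∈ s, p ⊆ x := by
  induction h with
  | refl => simp
  | step h _ _ ih =>
    intro x hx
    rcases Finset.mem_insert.1 hx with rfl | hx
    · exact subset_rfl
    · exact h.subset.trans (ih x hx)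

theorem mem_of_mem (h : PathThrough T D t p s) : ∀ x ∈ s, x ∈ D := by
  induction h with
  | refl => simp
  | step _ hD _ ih => exact Finset.forall_mem_insert _ _ _ |>.2 ⟨hD, ih⟩

theorem card_insert (h : T.IsNeighbor p p') (hp' : PathThrough T D t p' s) :
    (insert p s).card = s.card + 1 :=
  Finset.card_insert_of_notMem fun hps => h.ssubset.2 (hp'.subset_of_mem p hps)

/-- Either no state of the path is in `tr`, the list of states that the algorithm has been at, or
the rest of the path after its last state in `tr` starts inside the truncation. -/
theorem exists_fresh [Nonempty α] (ht : t ∈ T.trees) (h : PathThrough T D t p s)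
    (htr : ∀ S ∈ tr, ∀ A ∈ S, 1 < A.card → A ∈ E) :
    (∀ x ∈ s, x ∉ tr) ∨ ∃ p' s', PathThrough T D t p' s' ∧ p' ⊆ truncate E t ∧
      ∀ x ∈ s', x ∉ tr := by
  induction h with
  | refl => exact Or.inl (by simp)
  | @step p p' s h hD hp' ih =>
    rcases ih with ih | ih
    · by_cases hp : p ∈ tr
      · exact Or.inr ⟨p', s, hp', subset_truncate_of_explored ht h hp'.subset (htr p hp), ih⟩
      · exact Or.inl ((Finset.forall_mem_insert _ _ _).2 ⟨hp, ih⟩)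
    · exact Or.inr ih

end PathThrough

section Nonempty

variable [Nonempty α]

/-- As soon as the optimal cost is reached, ties can be broken in favour of a cheapest tree `t`,
and then the algorithm needs no more passes than any path to `t` has edges. -/
theorem PathThrough.exists_returns {D : Set (Finset (Finset α))}
    {s : Finset (Finset (Finset α))} (hH : ∀ x : α, H {x} = 0)
    (hcons : (T.stateSpace ψ H).Consistent) (ht : t ∈ T.trees) (h : PathThrough T D t p s) :
    ∀ E tr, TrellisRun T ψ H E tr → p ⊆ truncate E t →
      (∀ Ξ, IsPointers T ψ H E Ξ → fval ψ H t ≤ fval ψ H (treeOf Ξ Finset.univ)) →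
      ∃ tr' r S, TrellisReturns T ψ H tr' r S ∧ tr'.length ≤ tr.length + s.card := by
  have hsel : ∀ E tr, TrellisRun T ψ H E tr →
      (∀ Ξ, IsPointers T ψ H E Ξ → fval ψ H t ≤ fval ψ H (treeOf Ξ Finset.univ)) →
      ∃ Ξ, IsPointers T ψ H E Ξ ∧ treeOf Ξ Finset.univ = truncate E t := by
    intro E tr hrun hopt
    have hE := hrun.isExplorable
    refine exists_isPointers_treeOf_eq hcons hE (isState_truncate hE ht)
      (isFrontier_truncate hE ht) fun Ξ hΞ => (fval_mono hcons (isState_truncate hE ht)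
        (isState_of_mem_trees ht) truncate_subset).trans (hopt Ξ hΞ)
  induction h with
  | refl =>
    intro E tr hrun htE hopt
    obtain ⟨Ξ, hΞ, hΞt⟩ := hsel E tr hrun hopt
    refine ⟨tr, _, _, ⟨E, Ξ, hrun, hΞ, ?_, rfl, rfl⟩, Nat.le_add_right _ _⟩
    rw [atGoal_iff hH (hΞ.isState hrun.isExplorable).1, hΞt, truncate_subset.antisymm htE]
    exact ht
  | @step p p' s hpp' hD hp' ih =>
    intro E tr hrun hpE hopt
    obtain ⟨Ξ, hΞ, hΞt⟩ := hsel E tr hrun hopt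
    by_cases hg : AtGoal H Ξ
    · exact ⟨tr, _, _, ⟨E, Ξ, hrun, hΞ, hg, rfl, rfl⟩, Nat.le_add_right _ _⟩
    · have hrun' := hrun.explore hΞ hg
      obtain ⟨tr', r, S, hret, hlen⟩ := ih _ _ hrun'
        (subset_truncate_of_isNeighbor ht hpp' hp'.subset
          (hpE.trans (truncate_mono Finset.subset_union_left)) (by
            intro A hA hc
            exact (hrun'.explored hH _ (by simp)).2.2 A (hΞt ▸ hpE hA) hc))
        (by
          intro Ξ' hΞ'
          obtain ⟨hS', hf'⟩ := hΞ'.isState hrun'.isExplorable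
          exact (hopt Ξ hΞ).trans (fval_treeOf_le hcons hrun.isExplorable hΞ hS'
            fun B hB hBE => (hf' B (lvs_subset hB)).1 hB (Finset.mem_union_left _ hBE)))
      refine ⟨tr', r, S, hret, hlen.trans ?_⟩
      rw [List.length_append, List.length_singleton, PathThrough.card_insert hpp' hp']
      omega

/-- The algorithm can run until its `f` value has reached the cost of a cheapest tree `t`. -/
theorem TrellisRun.exists_extension (hH : ∀ x : α, H {x} = 0)
    (hmin : ∀ S ∈ T.trees, fval ψ H t ≤ fval ψ H S) (n : ℕ) :
    ∀ E tr, T.clusters.card - tr.length = n → TrellisRun T ψ H E tr →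
      (∀ S ∈ tr, fval ψ H S < fval ψ H t) →
      ∃ E' tr', TrellisRun T ψ H E' tr' ∧ (∀ S ∈ tr', fval ψ H S < fval ψ H t) ∧
        ∀ Ξ, IsPointers T ψ H E' Ξ → fval ψ H t ≤ fval ψ H (treeOf Ξ Finset.univ) := by
  induction n using Nat.strong_induction_on with
  | _ n ih =>
    rintro E tr rfl hrun hlt
    by_cases hex : ∃ Ξ, IsPointers T ψ H E Ξ ∧ fval ψ H (treeOf Ξ Finset.univ) < fval ψ H t
    · obtain ⟨Ξ, hΞ, hlt'⟩ := hex
      have hg : ¬ AtGoal H Ξ := by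
        rw [atGoal_iff hH (hΞ.isState hrun.isExplorable).1]
        exact fun h => (hmin _ h).not_gt hlt'
      have hrun' := hrun.explore hΞ hg
      have hlen := hrun'.length_le hH
      rw [List.length_append, List.length_singleton] at hlen
      refine ih _ ?_ _ _ rfl hrun' ?_
      · rw [List.length_append, List.length_singleton]
        omega
      · intro S hS
        rw [List.mem_append, List.mem_singleton] at hS
        rcases hS with hS | rfl
        · exact hlt S hS
        · exact hlt'
    · push Not at hex
      exact ⟨E, tr, hrun, hlt, hex⟩

/-- Every admissible search algorithm expands all states with `f` below the optimal cost. -/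
theorem mem_expanded_of_fval_lt (hH : ∀ x : α, H {x} = 0)
    (hcons : (T.stateSpace ψ H).Consistent) (hS : T.IsState S)
    (hlt : (fval ψ H S : ℝ≥0∞) < (T.stateSpace ψ H).optCost)
    {B : SearchAlgorithm (Finset (Finset α))} (hB : B.Admissible)
    {l : List (Finset (Finset α) × (Finset (Finset α) → ℝ≥0∞))} {r : ℝ≥0∞}
    (h : B.Halts (T.stateSpace ψ H) l r t) : S ∈ l.map Prod.fst := by
  refine hB.mem_expanded hcons (fun _ ht => treeHeur_eq_zero hH ht) optCost_ne_top h
    (pathCost_treeCost ψ H hS) ?_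
  rwa [fval, ENNReal.coe_add] at hlt

/-- The passes with `f` below the optimal cost are at states that `B` has to expand. The later ones
are matched with the states of a cheapest path expanded by `B` that have not occurred before. -/
theorem exists_returns_length_le (hH : ∀ x : α, H {x} = 0)
    (hcons : (T.stateSpace ψ H).Consistent) {B : SearchAlgorithm (Finset (Finset α))}
    (hB : B.Admissible) {l : List (Finset (Finset α) × (Finset (Finset α) → ℝ≥0∞))} {r : ℝ≥0∞}
    (h : B.Halts (T.stateSpace ψ H) l r t) :
    ∃ tr r' S, TrellisReturns T ψ H tr r' S ∧ tr.length ≤ (l.map Prod.fst).toFinset.card := by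
  obtain ⟨ht, hpath, hR⟩ := hB.exists_expanded_path hcons
    (fun _ ht => treeHeur_eq_zero hH ht) optCost_ne_top h
  replace ht : t ∈ T.trees := ht
  have hcost : (T.stateSpace ψ H).optCost = fval ψ H t := by
    rw [fval_of_mem_trees hH ht]
    exact (pathCost_eq hpath).resolve_left optCost_ne_top
  have hmin : ∀ S ∈ T.trees, fval ψ H t ≤ fval ψ H S := by
    intro S hS
    rw [← ENNReal.coe_le_coe, ← hcost, fval_of_mem_trees hH hS]
    exact optCost_le_treeCost hS
  obtain ⟨E, tr, hrun, hlt, hopt⟩ :=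
    TrellisRun.exists_extension hH hmin _ ∅ [] rfl .initial (by simp)
  have hexp := hrun.explored hH
  obtain ⟨s₀, hs₀⟩ : ∃ s, PathThrough T {v | v ∈ l.map Prod.fst} t
      (T.stateSpace ψ H).start s := by
    generalize (T.stateSpace ψ H).start = u at hR
    induction hR using Relation.ReflTransGen.head_induction_on with
    | refl => exact ⟨∅, .refl⟩
    | head hvw _ ih =>
      obtain ⟨s, hs⟩ := ih
      exact ⟨_, .step (not_not.1 fun h => hvw.1 (cost_eq_top h)) hvw.2 hs⟩
  obtain ⟨p, s, hs, hp, hfresh⟩ : ∃ p s, PathThrough T {v | v ∈ l.map Prod.fst} t p s ∧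
      p ⊆ truncate E t ∧ ∀ x ∈ s, x ∉ tr := by
    rcases hs₀.exists_fresh ht fun S hS => (hexp S hS).2.2 with h | h
    · exact ⟨_, _, hs₀, Finset.singleton_subset_iff.2 (univ_mem_truncate ht), h⟩
    · exact h
  obtain ⟨tr', r', S, hret, hlen⟩ := hs.exists_returns hH hcons ht E tr hrun hp hopt
  refine ⟨tr', r', S, hret, hlen.trans ?_⟩
  have hd : Disjoint tr.toFinset s := by
    rw [Finset.disjoint_right]
    exact fun x hx hxt => hfresh x hx (List.mem_toFinset.1 hxt)
  rw [← List.toFinset_card_of_nodup (hrun.nodup hH), ← Finset.card_union_of_disjoint hd]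
  refine Finset.card_le_card (Finset.union_subset (fun x hx => ?_) fun x hx => ?_)
  · rw [List.mem_toFinset] at hx ⊢
    refine mem_expanded_of_fval_lt hH hcons (hexp x hx).1 ?_ hB h
    rw [hcost, ENNReal.coe_lt_coe]
    exact hlt x hx
  · exact List.mem_toFinset.2 (hs.mem_of_mem x hx)

end Nonempty

end

end HClust

theorem mainTheorem5 {α : Type*} [Fintype α] [DecidableEq α] [Nonempty α]
    (T : Trellis α) (ψ : Sym2 (Finset α) → ℝ≥0) (H : Finset α → ℝ≥0)
    (hH : ∀ x : α, H {x} = 0)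
    (hcons : (T.stateSpace ψ H).Consistent) :
    -- The algorithm never gets stuck, never repeats a state, and stops.
    (∀ E tr, TrellisRun T ψ H E tr →
      (∃ Ξ, IsPointers T ψ H E Ξ) ∧ tr.Nodup ∧ tr.length ≤ T.clusters.card) ∧
    -- What it returns is a cheapest tree in the trellis, with its cost.
    (∀ tr r S, TrellisReturns T ψ H tr r S →
      S ∈ T.trees ∧ r = treeCost ψ S ∧ (∀ S' ∈ T.trees, treeCost ψ S ≤ treeCost ψ S') ∧
        (r : ℝ≥0∞) = (T.stateSpace ψ H).optCost) ∧
    -- It simulates A* on the space of partial trees: some run of A* has expanded all states that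
    -- the algorithm has gone through, in the same order, otherwise only states with a leaf that is
    -- explored already, and selects next the state which the algorithm is at, to return it or to
    -- expand it as the algorithm does.
    (∀ E tr Ξ, TrellisRun T ψ H E tr → IsPointers T ψ H E Ξ →
      ∃ l c, AStarRun (T.stateSpace ψ H) l c ∧ tr.Sublist l ∧
        (∀ S ∈ l, ∃ A ∈ lvs S, A ∈ E) ∧
        c.Selects (T.stateSpace ψ H) (treeOf Ξ Finset.univ) ∧
        c.g (treeOf Ξ Finset.univ) = treeCost ψ (treeOf Ξ Finset.univ) ∧
        (AtGoal H Ξ ↔ treeOf Ξ Finset.univ ∈ (T.stateSpace ψ H).goal)) ∧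
    -- Optimal efficiency: no explored state has `f` above the optimal cost, and every admissible
    -- search algorithm expands all explored states with `f` below the optimal cost.
    (∀ E tr, TrellisRun T ψ H E tr → ∀ S ∈ tr,
      ((treeCost ψ S + treeHeur H S : ℝ≥0) : ℝ≥0∞) ≤ (T.stateSpace ψ H).optCost ∧
      (((treeCost ψ S + treeHeur H S : ℝ≥0) : ℝ≥0∞) < (T.stateSpace ψ H).optCost →
        ∀ B : SearchAlgorithm (Finset (Finset α)), B.Admissible →
          ∀ l r t, B.Halts (T.stateSpace ψ H) l r t → S ∈ l.map Prod.fst)) ∧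
    -- Optimal efficiency with ties: for every admissible search algorithm there is a way of
    -- breaking ties such that at most as many states are explored as that algorithm expands.
    (∀ B : SearchAlgorithm (Finset (Finset α)), B.Admissible →
      ∀ l r t, B.Halts (T.stateSpace ψ H) l r t →
        ∃ tr r' S, TrellisReturns T ψ H tr r' S ∧
          tr.length ≤ (l.map Prod.fst).toFinset.card) := by
  refine ⟨fun E tr h => ?_, ?_, ?_, ?_, ?_⟩
  · obtain ⟨Ξ, hΞ, -⟩ := exists_isPointers (ψ := ψ) (H := H) h.isExplorable ∅
    exact ⟨⟨Ξ, hΞ⟩, h.nodup hH, h.length_le hH⟩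
  · rintro tr r S ⟨E, Ξ, hrun, hΞ, hg, rfl, rfl⟩
    rw [atGoal_iff hH (hΞ.isState hrun.isExplorable).1] at hg
    have hr : treeCost ψ (treeOf Ξ Finset.univ) + treeHeur H (treeOf Ξ Finset.univ) =
        treeCost ψ (treeOf Ξ Finset.univ) := fval_of_mem_trees hH hg
    have hmin : ∀ S' ∈ T.trees, treeCost ψ (treeOf Ξ Finset.univ) ≤ treeCost ψ S' := by
      intro S' hS'
      have := fval_treeOf_le_of_mem_trees hcons hrun.isExplorable hΞ hS'
      rwa [fval_of_mem_trees hH hg, fval_of_mem_trees hH hS'] at this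
    refine ⟨hg, hr, hmin, ?_⟩
    rw [hr]
    exact (le_optCost fun S' hS' => ENNReal.coe_le_coe.2 (hmin S' hS')).antisymm
      (optCost_le_treeCost hg)
  · intro E tr Ξ hrun hΞ
    obtain ⟨l, c, hl, htr, hlE⟩ := hrun.exists_aStarRun hH hcons
    obtain ⟨l', c', h1, h2, h3, h4, h5⟩ :=
      exists_selects hcons hrun.isExplorable hΞ _ l c rfl hl hlE
    exact ⟨l', c', h1, htr.trans h2, h3, h4, h5, atGoal_iff hH (hΞ.isState hrun.isExplorable).1⟩
  · intro E tr hrun S hS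
    exact ⟨fval_le_optCost_of_mem_run hH hcons hrun S hS, fun hlt B hB l r t h =>
      mem_expanded_of_fval_lt hH hcons (hrun.explored hH S hS).1 hlt hB h⟩
  · intro B hB l r t h
    exact exists_returns_length_le hH hcons hB h
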